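/- Let $\mathrm{SO}(m)$ be the group of real orthogonal $m\times m$ matrices of determinant $1$. A subgroup $H$ of a group $G$ is said to strongly control fusion (SCF) in $G$ if, for all subsets $B_1,B_2\subseteq H$ and every $g\in G$ with $gB_1g^{-1}=B_2$, there is $h\in H$ such that $gbg^{-1}=hbh^{-1}$ for all $b\in B_1$. For every integer $n\ge 0$ there is a continuous homomorphism $\rho_n:\mathrm{SO}(3)\to\mathrm{SO}(2n+1)$ for which the resulting representation of $\mathrm{SO}(3)$ on $\mathbb{C}^{2n+1}$ is irreducible, and for every choice of such homomorphisms: 1. for every $n\ge 2$, the image $\rho_n(\mathrm{SO}(3))$ does not strongly control fusion in $\mathrm{SO}(2n+1)$; 2. the image of the block-diagonal sum $\rho_1\oplus\rho_2:\mathrm{SO}(3)\to\mathrm{SO}(8)$ strongly controls fusion in $\mathrm{SO}(8)$. -/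

import Mathlib

/-- The compact group `SO(m)` of real orthogonal `m × m` matrices of determinant one. -/
abbrev SO (m : ℕ) : Type :=
  Matrix.specialOrthogonalGroup (Fin m) ℝ

/-- A subgroup `H` of `G` strongly controls fusion in `G` if, whenever `g ∈ G` conjugates a subset
`B₁` of `H` onto a subset `B₂` of `H`, some `h ∈ H` has the same conjugation action on `B₁`
as `g`. -/
def StronglyControlsFusion {G : Type*} [Group G] (H : Subgroup G) : Prop :=
  ∀ B₁ B₂ : Set G, B₁ ⊆ (H : Set G) → B₂ ⊆ (H : Set G) →
    ∀ g : G, (fun b => g * b * g⁻¹) '' B₁ = B₂ →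
      ∃ h ∈ H, ∀ b ∈ B₁, g * b * g⁻¹ = h * b * h⁻¹

/-- The complex representation on `ℂ^m` given by a homomorphism into `SO(m)`, that is, by its
composite with `SO(m) ⊆ SU(m)`. -/
noncomputable def complexRep {Γ : Type*} [Group Γ] {m : ℕ} (ρ : Γ →* SO m) :
    Representation ℂ Γ (Fin m → ℂ) where
  toFun A := Matrix.toLin' ((ρ A : Matrix (Fin m) (Fin m) ℝ).map Complex.ofRealHom)
  map_one' := by
    rw [map_one, Submonoid.coe_one, Matrix.map_one _ (map_zero _) (map_one _), Matrix.toLin'_one]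
    rfl
  map_mul' A B := by
    rw [map_mul, Submonoid.coe_mul, Matrix.map_mul, Matrix.toLin'_mul]
    rfl

/-- `ρ : SO(3) → SO(m)` is an irreducible `m`-dimensional representation of the Lie group `SO(3)`:
it is continuous, and the representation on `ℂ^m` is irreducible. -/
def IsIrrepOfSO3 {m : ℕ} (ρ : SO 3 →* SO m) : Prop :=
  Continuous ρ ∧ (complexRep ρ).IsIrreducible

/-- The block diagonal matrix with blocks `A` and `B`, with rows and columns numbered
consecutively. -/
def blockDiag {a b : ℕ} (A : Matrix (Fin a) (Fin a) ℝ) (B : Matrix (Fin b) (Fin b) ℝ) :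
    Matrix (Fin (a + b)) (Fin (a + b)) ℝ :=
  Matrix.reindex finSumFinEquiv finSumFinEquiv (Matrix.fromBlocks A 0 0 B)

theorem blockDiag_one (a b : ℕ) :
    blockDiag (1 : Matrix (Fin a) (Fin a) ℝ) (1 : Matrix (Fin b) (Fin b) ℝ) = 1 := by
  simp [blockDiag, Matrix.fromBlocks_one]

theorem blockDiag_mul {a b : ℕ} (A A' : Matrix (Fin a) (Fin a) ℝ)
    (B B' : Matrix (Fin b) (Fin b) ℝ) :
    blockDiag (A * A') (B * B') = blockDiag A B * blockDiag A' B' := by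
  simp [blockDiag, Matrix.fromBlocks_multiply, Matrix.submatrix_mul_equiv]

theorem blockDiag_mem {a b : ℕ} (A : SO a) (B : SO b) :
    blockDiag (A : Matrix (Fin a) (Fin a) ℝ) (B : Matrix (Fin b) (Fin b) ℝ) ∈
      Matrix.specialOrthogonalGroup (Fin (a + b)) ℝ := by
  obtain ⟨A, hA⟩ := A
  obtain ⟨B, hB⟩ := B
  rw [Matrix.mem_specialOrthogonalGroup_iff, Matrix.mem_orthogonalGroup_iff] at hA hB ⊢
  constructor
  · have h : (blockDiag A B).transpose = blockDiag A.transpose B.transpose := by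
      simp [blockDiag, Matrix.fromBlocks_transpose]
    rw [h, ← blockDiag_mul, hA.1, hB.1, blockDiag_one]
  · simp [blockDiag, hA.2, hB.2]

/-- The direct sum `ρ ⊕ σ` of orthogonal representations, with values in `SO(a + b)`. -/
def directSumRep {Γ : Type*} [Group Γ] {a b : ℕ} (ρ : Γ →* SO a) (σ : Γ →* SO b) :
    Γ →* SO (a + b) where
  toFun x := ⟨blockDiag (ρ x) (σ x), blockDiag_mem (ρ x) (σ x)⟩
  map_one' := Subtype.ext (by simp [blockDiag_one])
  map_mul' x y := Subtype.ext (by simp [blockDiag_mul])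

open Matrix Real
open scoped Topology MonoidAlgebra InnerProductSpace

/-! ### Elements of `SO(m)` -/

namespace SO

variable {m : ℕ}

theorem mul_transpose (g : SO m) : (g : Matrix (Fin m) (Fin m) ℝ) * (g : Matrix _ _ ℝ)ᵀ = 1 :=
  (mem_orthogonalGroup_iff _ _).1 (mem_specialOrthogonalGroup_iff.1 g.2).1

theorem transpose_mul (g : SO m) : (g : Matrix (Fin m) (Fin m) ℝ)ᵀ * (g : Matrix _ _ ℝ) = 1 :=
  (mem_orthogonalGroup_iff' _ _).1 (mem_specialOrthogonalGroup_iff.1 g.2).1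

theorem det_eq_one (g : SO m) : (g : Matrix (Fin m) (Fin m) ℝ).det = 1 :=
  (mem_specialOrthogonalGroup_iff.1 g.2).2

theorem coe_inv (g : SO m) : ((g⁻¹ : SO m) : Matrix (Fin m) (Fin m) ℝ) = (g : Matrix _ _ ℝ)ᵀ :=
  rfl

/-- The element of `SO(m)` given by an orthogonal matrix of determinant one. -/
def mk (M : Matrix (Fin m) (Fin m) ℝ) (h : M * Mᵀ = 1) (hd : M.det = 1) : SO m :=
  ⟨M, mem_specialOrthogonalGroup_iff.2 ⟨(mem_orthogonalGroup_iff _ _).2 h, hd⟩⟩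

@[simp]
theorem coe_mk (M : Matrix (Fin m) (Fin m) ℝ) (h : M * Mᵀ = 1) (hd : M.det = 1) :
    (mk M h hd : Matrix (Fin m) (Fin m) ℝ) = M := rfl

theorem trace_conj (g x : SO m) :
    trace ((g * x * g⁻¹ : SO m) : Matrix (Fin m) (Fin m) ℝ) = trace (x : Matrix (Fin m) (Fin m) ℝ) := by
  rw [Submonoid.coe_mul, Submonoid.coe_mul, coe_inv, Matrix.trace_mul_cycle, transpose_mul,
    Matrix.one_mul]

end SO

/-! ### Rotations about the coordinate axes -/

/-- The rotation by `t` about the first coordinate axis. -/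
noncomputable def rotX (t : ℝ) : SO 3 :=
  SO.mk !![1, 0, 0; 0, cos t, -sin t; 0, sin t, cos t]
    (by
      ext i j
      fin_cases i <;> fin_cases j <;>
        simp [Matrix.mul_apply, Fin.sum_univ_three] <;>
          first
          | linear_combination cos_sq_add_sin_sq t
          | ring)
    (by simp [Matrix.det_fin_three]; linear_combination cos_sq_add_sin_sq t)

/-- The rotation by `t` about the second coordinate axis. -/
noncomputable def rotY (t : ℝ) : SO 3 :=
  SO.mk !![cos t, 0, sin t; 0, 1, 0; -sin t, 0, cos t]
    (by
      ext i j
      fin_cases i <;> fin_cases j <;>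
        simp [Matrix.mul_apply, Fin.sum_univ_three] <;>
          first
          | linear_combination cos_sq_add_sin_sq t
          | ring)
    (by simp [Matrix.det_fin_three]; linear_combination cos_sq_add_sin_sq t)

/-- The rotation by `t` about the third coordinate axis. -/
noncomputable def rotZ (t : ℝ) : SO 3 :=
  SO.mk !![cos t, -sin t, 0; sin t, cos t, 0; 0, 0, 1]
    (by
      ext i j
      fin_cases i <;> fin_cases j <;>
        simp [Matrix.mul_apply, Fin.sum_univ_three] <;>
          first
          | linear_combination cos_sq_add_sin_sq t
          | ring)
    (by simp [Matrix.det_fin_three]; linear_combination cos_sq_add_sin_sq t)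

/-- The rotation permuting the coordinate axes cyclically. -/
def rotCyc : SO 3 :=
  SO.mk !![0, 0, 1; 1, 0, 0; 0, 1, 0]
    (by
      ext i j
      fin_cases i <;> fin_cases j <;> simp [Matrix.mul_apply, Fin.sum_univ_three])
    (by simp [Matrix.det_fin_three])

theorem rotZ_add (s t : ℝ) : rotZ (s + t) = rotZ s * rotZ t := by
  apply Subtype.ext
  ext i j
  fin_cases i <;> fin_cases j <;>
    simp [rotZ, Matrix.mul_apply, Fin.sum_univ_three, cos_add, sin_add] <;> ring

theorem rotZ_zero : rotZ 0 = 1 := by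
  apply Subtype.ext
  ext i j
  fin_cases i <;> fin_cases j <;> simp [rotZ]

theorem continuous_rotZ : Continuous rotZ := by
  refine Continuous.subtype_mk (continuous_matrix fun i j => ?_) _
  fin_cases i <;> fin_cases j <;> simp <;> fun_prop

theorem rotCyc_mul_rotX (t : ℝ) : rotCyc * rotX t * rotCyc⁻¹ = rotY t := by
  rw [mul_inv_eq_iff_eq_mul]
  apply Subtype.ext
  ext i j
  fin_cases i <;> fin_cases j <;>
    simp [rotX, rotY, rotCyc, Matrix.mul_apply, Fin.sum_univ_three]

theorem rotCyc_mul_rotY (t : ℝ) : rotCyc * rotY t * rotCyc⁻¹ = rotZ t := by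
  rw [mul_inv_eq_iff_eq_mul]
  apply Subtype.ext
  ext i j
  fin_cases i <;> fin_cases j <;>
    simp [rotZ, rotY, rotCyc, Matrix.mul_apply, Fin.sum_univ_three]

theorem rotCyc_mul_rotZ (t : ℝ) : rotCyc * rotZ t * rotCyc⁻¹ = rotX t := by
  rw [mul_inv_eq_iff_eq_mul]
  apply Subtype.ext
  ext i j
  fin_cases i <;> fin_cases j <;>
    simp [rotX, rotZ, rotCyc, Matrix.mul_apply, Fin.sum_univ_three]

theorem trace_rotZ (t : ℝ) : trace (rotZ t : Matrix (Fin 3) (Fin 3) ℝ) = 1 + 2 * cos t := by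
  simp [rotZ, Matrix.trace_fin_three]
  ring

theorem rotZ_eq_one_of_cos_eq_one {t : ℝ} (h : cos t = 1) : rotZ t = 1 := by
  have hs : sin t = 0 := by nlinarith [cos_sq_add_sin_sq t]
  apply Subtype.ext
  ext i j
  fin_cases i <;> fin_cases j <;> simp [rotZ, h, hs]

theorem exists_polar (x y : ℝ) : ∃ t : ℝ, x = √(x ^ 2 + y ^ 2) * cos t ∧
    y = √(x ^ 2 + y ^ 2) * sin t := by
  refine ⟨Complex.arg ⟨x, y⟩, ?_⟩
  have h : √(x ^ 2 + y ^ 2) = ‖(⟨x, y⟩ : ℂ)‖ := by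
    rw [Complex.norm_def, Complex.normSq_mk]; congr 1; ring
  rw [h, Complex.norm_mul_cos_arg, Complex.norm_mul_sin_arg]
  exact ⟨rfl, rfl⟩

/-- The orthogonality relations between the rows and the columns of a matrix in `SO(3)`. -/
theorem SO.row_col (g : SO 3) (i j : Fin 3) :
    (g.1 i 0 * g.1 j 0 + g.1 i 1 * g.1 j 1 + g.1 i 2 * g.1 j 2 = if i = j then 1 else 0) ∧
    (g.1 0 i * g.1 0 j + g.1 1 i * g.1 1 j + g.1 2 i * g.1 2 j = if i = j then 1 else 0) := by
  have h₁ := congrFun (congrFun g.mul_transpose i) j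
  have h₂ := congrFun (congrFun g.transpose_mul i) j
  simp only [Matrix.mul_apply, Fin.sum_univ_three, Matrix.transpose_apply, Matrix.one_apply]
    at h₁ h₂
  exact ⟨h₁, h₂⟩

theorem SO.det_expand (g : SO 3) :
    g.1 0 0 * g.1 1 1 * g.1 2 2 - g.1 0 0 * g.1 1 2 * g.1 2 1 - g.1 0 1 * g.1 1 0 * g.1 2 2
      + g.1 0 1 * g.1 1 2 * g.1 2 0 + g.1 0 2 * g.1 1 0 * g.1 2 1
      - g.1 0 2 * g.1 1 1 * g.1 2 0 = 1 := by
  have := g.det_eq_one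
  rwa [Matrix.det_fin_three] at this

theorem exists_eq_rotZ {g : SO 3} (h : g.1 2 2 = 1) : ∃ t, g = rotZ t := by
  have r22 := (g.row_col 2 2).1
  have c22 := (g.row_col 2 2).2
  have c00 := (g.row_col 0 0).2
  have c01 := (g.row_col 0 1).2
  have c11 := (g.row_col 1 1).2
  have hd := g.det_expand
  simp [h] at r22 c22 c00 c01 c11 hd
  have h20 : g.1 2 0 = 0 := by nlinarith [sq_nonneg (g.1 2 0), sq_nonneg (g.1 2 1)]
  have h21 : g.1 2 1 = 0 := by nlinarith [sq_nonneg (g.1 2 0), sq_nonneg (g.1 2 1)]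
  have h02 : g.1 0 2 = 0 := by nlinarith [sq_nonneg (g.1 0 2), sq_nonneg (g.1 1 2)]
  have h12 : g.1 1 2 = 0 := by nlinarith [sq_nonneg (g.1 0 2), sq_nonneg (g.1 1 2)]
  simp [h20, h21, h02, h12] at c00 c01 c11 hd
  obtain ⟨t, hx, hy⟩ := exists_polar (g.1 0 0) (g.1 1 0)
  have h1 : √(g.1 0 0 ^ 2 + g.1 1 0 ^ 2) = 1 := by rw [sqrt_eq_one]; linarith
  rw [h1, one_mul] at hx hy
  have h11 : g.1 1 1 = g.1 0 0 := by
    linear_combination g.1 0 0 * hd - g.1 1 1 * c00 + g.1 1 0 * c01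
  have h01 : g.1 0 1 = - g.1 1 0 := by
    linear_combination g.1 0 0 * c01 - g.1 0 1 * c00 - g.1 1 0 * hd
  refine ⟨t, Subtype.ext ?_⟩
  ext i j
  fin_cases i <;> fin_cases j <;> simp [rotZ, h, h20, h21, h02, h12, h11, h01, ← hx, ← hy]

/-- Some product of rotations takes the third basis vector to a given unit vector. -/
theorem exists_rotZ_mul_rotY (x y z : ℝ) (h : x ^ 2 + y ^ 2 + z ^ 2 = 1) :
    ∃ a b : ℝ, (rotZ a * rotY b).1 0 2 = x ∧ (rotZ a * rotY b).1 1 2 = y ∧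
      (rotZ a * rotY b).1 2 2 = z := by
  obtain ⟨a, hx, hy⟩ := exists_polar x y
  obtain ⟨b, hz, hr⟩ := exists_polar z (√(x ^ 2 + y ^ 2))
  have h1 : √(z ^ 2 + √(x ^ 2 + y ^ 2) ^ 2) = 1 := by
    rw [sqrt_eq_one, sq_sqrt (by positivity)]; linarith
  rw [h1, one_mul] at hz hr
  refine ⟨a, b, ?_⟩
  simp [rotZ, rotY, Matrix.mul_apply, Fin.sum_univ_three]
  refine ⟨?_, ?_, hz.symm⟩
  · rw [← hr, mul_comm]; exact hx.symm
  · rw [← hr, mul_comm]; exact hy.symm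

theorem exists_euler (g : SO 3) : ∃ a b c : ℝ, g = rotZ a * rotY b * rotZ c := by
  have h := (g.row_col 2 2).2
  simp at h
  obtain ⟨a, b, hx, hy, hz⟩ := exists_rotZ_mul_rotY (g.1 0 2) (g.1 1 2) (g.1 2 2) (by linarith)
  obtain ⟨c, hc⟩ := exists_eq_rotZ (g := (rotZ a * rotY b)⁻¹ * g) (by
    rw [Submonoid.coe_mul, SO.coe_inv, Matrix.mul_apply, Fin.sum_univ_three]
    simp only [Matrix.transpose_apply]
    rw [hx, hy, hz, h])
  exact ⟨a, b, c, by rw [← hc]; group⟩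

/-- Every rotation is conjugate to a rotation about the third coordinate axis. -/
theorem exists_conj_rotZ (g : SO 3) : ∃ (y : SO 3) (t : ℝ), g = y * rotZ t * y⁻¹ := by
  have hdet : (g.1 - 1).det = 0 := by
    have h : (g.1 - 1) * g.1ᵀ = -(g.1 - 1)ᵀ := by
      rw [Matrix.sub_mul, g.mul_transpose]; simp
    have h' := congrArg Matrix.det h
    rw [Matrix.det_mul, Matrix.det_transpose, Matrix.det_neg, Matrix.det_transpose,
      g.det_eq_one] at h'
    simp at h'
    linarith
  obtain ⟨v, hv, hgv⟩ := Matrix.exists_mulVec_eq_zero_iff.2 hdet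
  rw [Matrix.sub_mulVec, Matrix.one_mulVec, sub_eq_zero] at hgv
  have hpos : 0 < v 0 ^ 2 + v 1 ^ 2 + v 2 ^ 2 := by
    obtain ⟨i, hi⟩ := Function.ne_iff.1 hv
    have := sq_nonneg (v 0)
    have := sq_nonneg (v 1)
    have := sq_nonneg (v 2)
    have : 0 < v i ^ 2 := by have : v i ≠ 0 := hi; positivity
    fin_cases i <;> simp at this <;> linarith
  set r := √(v 0 ^ 2 + v 1 ^ 2 + v 2 ^ 2) with hr
  have hr0 : r ≠ 0 := (sqrt_pos.2 hpos).ne'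
  have hr2 : r ^ 2 = v 0 ^ 2 + v 1 ^ 2 + v 2 ^ 2 := sq_sqrt hpos.le
  obtain ⟨a, b, hx, hy, hz⟩ := exists_rotZ_mul_rotY (v 0 / r) (v 1 / r) (v 2 / r) (by
    field_simp; linarith)
  set y := rotZ a * rotY b
  have hfix (i : Fin 3) : y.1 i 2 = v i / r := by fin_cases i <;> assumption
  have hg (i : Fin 3) : ∑ j, g.1 i j * y.1 j 2 = y.1 i 2 := by
    have := congrFun hgv i
    simp only [Matrix.mulVec, dotProduct] at this
    simp_rw [hfix, ← mul_div_assoc]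
    rw [← Finset.sum_div, this]
  obtain ⟨t, ht⟩ := exists_eq_rotZ (g := y⁻¹ * (g * y)) (by
    have := (y.row_col 2 2).2
    rw [Submonoid.coe_mul, SO.coe_inv, Matrix.mul_apply]
    have hmul (i : Fin 3) : (g * y).1 i 2 = y.1 i 2 := by
      rw [Submonoid.coe_mul, Matrix.mul_apply, hg]
    simp_rw [hmul, Matrix.transpose_apply]
    rw [Fin.sum_univ_three, this]; simp)
  exact ⟨y, t, by rw [← ht]; group⟩

theorem eq_rotY {g : SO 3} (h0 : 0 < g.1 0 0) (h2 : 0 < g.1 2 2) (h01 : g.1 0 1 = 0)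
    (h12 : g.1 1 2 = 0) : g = rotY (arcsin (g.1 0 2)) := by
  have r00 := (g.row_col 0 0).1
  have c22 := (g.row_col 2 2).2
  have r01 := (g.row_col 0 1).1
  have r02 := (g.row_col 0 2).1
  have r11 := (g.row_col 1 1).1
  have c12 := (g.row_col 1 2).2
  have hd := g.det_expand
  simp [h01, h12] at r00 c22 r01 r02 r11 c12 hd
  have h10 : g.1 1 0 = 0 := r01.resolve_left h0.ne'
  have h21 : g.1 2 1 = 0 := c12.resolve_right h2.ne'
  have h02 : g.1 0 0 = g.1 2 2 := by nlinarith
  have h20 : g.1 2 0 = -g.1 0 2 := by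
    rw [← h02] at r02
    have : g.1 0 0 * (g.1 2 0 + g.1 0 2) = 0 := by linarith
    linarith [(mul_eq_zero.1 this).resolve_left h0.ne']
  have h11 : g.1 1 1 = 1 := by
    simp only [h20, h10, ← h02] at hd
    linear_combination hd - g.1 1 1 * r00
  have hsin : sin (arcsin (g.1 0 2)) = g.1 0 2 :=
    sin_arcsin (by nlinarith) (by nlinarith)
  have hcos : cos (arcsin (g.1 0 2)) = g.1 0 0 := by
    rw [cos_arcsin, sqrt_eq_iff_mul_self_eq (by nlinarith) h0.le]
    linarith
  apply Subtype.ext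
  ext i j
  fin_cases i <;> fin_cases j <;>
    simp [rotY, h10, h21, h20, h11, h01, h12, hsin, hcos, h02]

theorem sin_arctan_mul (x : ℝ) {y : ℝ} (hy : 0 < y) :
    sin (arctan (x / y)) * y = cos (arctan (x / y)) * x := by
  have h := tan_arctan (x / y)
  rw [tan_eq_sin_div_cos, div_eq_div_iff (cos_arctan_pos _).ne' hy.ne'] at h
  rw [h, mul_comm]

/-- Tait–Bryan angles of a rotation near the identity. -/
theorem eq_rotX_mul_rotY_mul_rotZ {g : SO 3} (h0 : 0 < g.1 0 0) (h2 : 0 < g.1 2 2) :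
    g = rotX (arctan (-g.1 1 2 / g.1 2 2)) * rotY (arcsin (g.1 0 2)) *
      rotZ (arctan (-g.1 0 1 / g.1 0 0)) := by
  set a := arctan (-g.1 1 2 / g.1 2 2)
  set c := arctan (-g.1 0 1 / g.1 0 0)
  have ha : sin a * g.1 2 2 = cos a * -g.1 1 2 := sin_arctan_mul _ h2
  have hc : sin c * g.1 0 0 = cos c * -g.1 0 1 := sin_arctan_mul _ h0
  have hapos : 0 < cos a := cos_arctan_pos _
  have hcpos : 0 < cos c := cos_arctan_pos _
  have hN (i j : Fin 3) : ((rotX a)⁻¹ * g * (rotZ c)⁻¹).1 i j =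
      ((rotX a).1ᵀ * g.1 * (rotZ c).1ᵀ) i j := rfl
  have h := eq_rotY (g := (rotX a)⁻¹ * g * (rotZ c)⁻¹)
    (by
      rw [hN]
      simp [rotX, rotZ, Matrix.mul_apply, Fin.sum_univ_three]
      have : cos c * (g.1 0 0 * cos c + -(g.1 0 1 * sin c)) = g.1 0 0 := by
        linear_combination g.1 0 0 * cos_sq_add_sin_sq c - sin c * hc
      by_contra hle
      nlinarith)
    (by
      rw [hN]
      simp [rotX, rotZ, Matrix.mul_apply, Fin.sum_univ_three]
      have : cos a * (-(sin a * g.1 1 2) + cos a * g.1 2 2) = g.1 2 2 := by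
        linear_combination g.1 2 2 * cos_sq_add_sin_sq a - sin a * ha
      by_contra hle
      nlinarith)
    (by
      rw [hN]
      simp [rotX, rotZ, Matrix.mul_apply, Fin.sum_univ_three]
      linarith)
    (by
      rw [hN]
      simp [rotX, rotZ, Matrix.mul_apply, Fin.sum_univ_three]
      linarith)
  have h02 : ((rotX a)⁻¹ * g * (rotZ c)⁻¹).1 0 2 = g.1 0 2 := by
    rw [hN]
    simp [rotX, rotZ, Matrix.mul_apply, Fin.sum_univ_three]
  rw [h02] at h
  rw [← h]
  group

/-! ### Continuous one-parameter groups in a Banach algebra -/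

section OneParameter

variable {𝔸 : Type*} [NormedRing 𝔸] [NormedAlgebra ℝ 𝔸] [CompleteSpace 𝔸]

/-- A continuous one-parameter group in a Banach algebra is differentiable. -/
theorem exists_hasDerivAt_of_map_add {γ : ℝ → 𝔸} (hc : Continuous γ) (h0 : γ 0 = 1)
    (hadd : ∀ s t, γ (s + t) = γ s * γ t) : ∃ A : 𝔸, HasDerivAt γ A 0 := by
  set Γ : ℝ → 𝔸 := fun t => ∫ s in (0 : ℝ)..t, γ s with hΓ
  have hderiv (t : ℝ) : HasDerivAt Γ (γ t) t :=
    intervalIntegral.integral_hasDerivAt_right (hc.intervalIntegrable _ _)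
      (hc.stronglyMeasurableAtFilter _ _) hc.continuousAt
  obtain ⟨a, ha0, hunit⟩ : ∃ a : ℝ, a ≠ 0 ∧ IsUnit (a⁻¹ • Γ a) := by
    have hlim : Filter.Tendsto (fun a : ℝ => a⁻¹ • Γ a) (𝓝[≠] 0) (𝓝 1) := by
      have h := (hasDerivAt_iff_tendsto_slope.1 (hderiv 0))
      rw [h0] at h
      refine h.congr fun a => ?_
      simp [slope, hΓ]
    have hopen : {x : 𝔸 | IsUnit x} ∈ 𝓝 (1 : 𝔸) := Units.isOpen.mem_nhds isUnit_one
    obtain ⟨a, ha, ha'⟩ := ((hlim.eventually hopen).and self_mem_nhdsWithin).exists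
    exact ⟨a, ha', ha⟩
  obtain ⟨u, hu⟩ := hunit
  have hmul (t : ℝ) : γ t * (a⁻¹ • Γ a) = a⁻¹ • (Γ (t + a) - Γ t) := by
    rw [mul_smul_comm]
    congr 1
    have h1 : Γ (t + a) - Γ t = ∫ s in t..(t + a), γ s :=
      intervalIntegral.integral_interval_sub_left (hc.intervalIntegrable _ _)
        (hc.intervalIntegrable _ _)
    rw [h1]
    have h2 : ∫ s in t..(t + a), γ s = ∫ s in (0 : ℝ)..a, γ (t + s) := by
      rw [intervalIntegral.integral_comp_add_left (fun s => γ s) t, add_zero]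
    rw [h2]
    simp_rw [hadd]
    exact ((ContinuousLinearMap.mul ℝ 𝔸 (γ t)).intervalIntegral_comp_comm
      (hc.intervalIntegrable _ _)).symm
  have hγ (t : ℝ) : γ t = a⁻¹ • (Γ (t + a) - Γ t) * ↑u⁻¹ := by
    rw [← hmul, ← hu, mul_assoc, Units.mul_inv, mul_one]
  refine ⟨a⁻¹ • (γ (0 + a) - γ 0) * ↑u⁻¹, ?_⟩
  refine HasDerivAt.congr_of_eventuallyEq ?_ (Filter.Eventually.of_forall hγ)
  exact ((((hderiv (0 + a)).comp_add_const 0 a).sub (hderiv 0)).const_smul a⁻¹).mul_const _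

/-- A one-parameter group is the exponential of its generator. -/
theorem eq_exp_of_hasDerivAt_zero {γ : ℝ → 𝔸} (h0 : γ 0 = 1)
    (hadd : ∀ s t, γ (s + t) = γ s * γ t) {A : 𝔸} (hA : HasDerivAt γ A 0) (t : ℝ) :
    γ t = NormedSpace.exp (t • A) := by
  have hd (t : ℝ) : HasDerivAt γ (γ t * A) t := by
    have h1 : HasDerivAt (fun s => γ t * γ (s - t)) (γ t * A) t := by
      refine HasDerivAt.const_mul (γ t) ?_
      refine HasDerivAt.comp_sub_const t t ?_
      simpa using hA
    convert h1 using 2 with s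
    rw [← hadd]; congr 1; ring
  have he (t : ℝ) : HasDerivAt (fun t : ℝ => NormedSpace.exp (t • -A))
      (-A * NormedSpace.exp (t • -A)) t := hasDerivAt_exp_smul_const' (-A) t
  have hconst (t : ℝ) : HasDerivAt (fun t => γ t * NormedSpace.exp (t • -A)) 0 t := by
    convert (hd t).fun_mul (he t) using 1
    rw [← mul_assoc, ← add_mul]
    simp
  have hone := is_const_of_deriv_eq_zero (fun t => (hconst t).differentiableAt)
    (fun t => (hconst t).deriv) t 0
  simp only [h0, zero_smul, NormedSpace.exp_zero, mul_one] at hone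
  let : NormedAlgebra ℚ 𝔸 := NormedAlgebra.restrictScalars ℚ ℝ 𝔸
  calc γ t = γ t * (NormedSpace.exp (t • -A) * NormedSpace.exp (t • A)) := by
        rw [← NormedSpace.exp_add_of_commute, ← smul_add]
        · simp
        · exact ((Commute.refl A).neg_left.smul_left t).smul_right t
    _ = NormedSpace.exp (t • A) := by rw [← mul_assoc, hone, one_mul]

end OneParameter

/-! ### The Lie algebra action of a continuous representation of `SO(3)` -/

section LieAction

variable {V : Type*} [NormedAddCommGroup V] [NormedSpace ℂ V] [FiniteDimensional ℂ V]

/-- The operators `A`, `B`, `C` are the infinitesimal rotations about the coordinate axes in the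
representation `ρ`. -/
structure IsInfinitesimal (ρ : SO 3 →* (V →L[ℂ] V)) (A B C : V →L[ℂ] V) : Prop where
  hasDerivAt_x : HasDerivAt (fun t => ρ (rotX t)) A 0
  hasDerivAt_y : HasDerivAt (fun t => ρ (rotY t)) B 0
  hasDerivAt_z : HasDerivAt (fun t => ρ (rotZ t)) C 0
  conj_x : ρ rotCyc * A * ρ rotCyc⁻¹ = B
  conj_y : ρ rotCyc * B * ρ rotCyc⁻¹ = C
  conj_z : ρ rotCyc * C * ρ rotCyc⁻¹ = A

theorem exists_isInfinitesimal {ρ : SO 3 →* (V →L[ℂ] V)} (hρ : Continuous ρ) :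
    ∃ A B C, IsInfinitesimal ρ A B C := by
  have : CompleteSpace (V →L[ℂ] V) := FiniteDimensional.complete ℂ _
  obtain ⟨C, hC⟩ := exists_hasDerivAt_of_map_add (γ := fun t => ρ (rotZ t))
    (hρ.comp continuous_rotZ) (by simp [rotZ_zero]) (by simp [rotZ_add])
  have hA : HasDerivAt (fun t => ρ (rotX t)) (ρ rotCyc * C * ρ rotCyc⁻¹) 0 := by
    simp_rw [← rotCyc_mul_rotZ, map_mul]
    exact (hC.const_mul _).mul_const _
  have hB : HasDerivAt (fun t => ρ (rotY t))
      (ρ rotCyc * (ρ rotCyc * C * ρ rotCyc⁻¹) * ρ rotCyc⁻¹) 0 := by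
    simp_rw [← rotCyc_mul_rotX, map_mul]
    exact (hA.const_mul _).mul_const _
  refine ⟨_, _, C, hA, hB, hC, rfl, ?_, rfl⟩
  have hC' : HasDerivAt (fun t => ρ (rotZ t))
      (ρ rotCyc * (ρ rotCyc * (ρ rotCyc * C * ρ rotCyc⁻¹) * ρ rotCyc⁻¹) * ρ rotCyc⁻¹) 0 := by
    simp_rw [← rotCyc_mul_rotY, map_mul]
    exact (hB.const_mul _).mul_const _
  exact hC'.unique hC

theorem map_rotCyc_conj_mul {R : Type*} [Ring R] (ρ : SO 3 →* R) (X Y : R) :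
    ρ rotCyc * (X * Y) * ρ rotCyc⁻¹ =
      (ρ rotCyc * X * ρ rotCyc⁻¹) * (ρ rotCyc * Y * ρ rotCyc⁻¹) := by
  have : ρ rotCyc⁻¹ * ρ rotCyc = 1 := by rw [← map_mul]; simp
  calc _ = ρ rotCyc * X * 1 * Y * ρ rotCyc⁻¹ := by simp only [mul_one, mul_assoc]
    _ = _ := by rw [← this]; simp only [mul_assoc]

/-- The entries of a rotation about an axis in the plane spanned by the first two basis vectors. -/
theorem rotZ_mul_rotX_mul_entries (s t : ℝ) :
    (rotZ s * rotX t * rotZ (-s)).1 0 0 = cos s ^ 2 + cos t * sin s ^ 2 ∧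
    (rotZ s * rotX t * rotZ (-s)).1 0 1 = (1 - cos t) * cos s * sin s ∧
    (rotZ s * rotX t * rotZ (-s)).1 0 2 = sin s * sin t ∧
    (rotZ s * rotX t * rotZ (-s)).1 1 2 = -(cos s * sin t) ∧
    (rotZ s * rotX t * rotZ (-s)).1 2 2 = cos t := by
  simp [rotZ, rotX, Matrix.mul_apply, Fin.sum_univ_three]
  constructor <;> ring

namespace IsInfinitesimal

variable {ρ : SO 3 →* (V →L[ℂ] V)} {A B C : V →L[ℂ] V}

theorem map_rotX (h : IsInfinitesimal ρ A B C) (t : ℝ) : ρ (rotX t) = NormedSpace.exp (t • A) := by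
  have : CompleteSpace (V →L[ℂ] V) := FiniteDimensional.complete ℂ _
  refine eq_exp_of_hasDerivAt_zero (γ := fun t => ρ (rotX t)) ?_ ?_ h.hasDerivAt_x t
  · simp [← rotCyc_mul_rotZ, rotZ_zero]
  · intro s t
    rw [← map_mul]
    simp only [← rotCyc_mul_rotZ, rotZ_add]
    congr 1; group

theorem map_rotY (h : IsInfinitesimal ρ A B C) (t : ℝ) : ρ (rotY t) = NormedSpace.exp (t • B) := by
  have : CompleteSpace (V →L[ℂ] V) := FiniteDimensional.complete ℂ _
  refine eq_exp_of_hasDerivAt_zero (γ := fun t => ρ (rotY t)) ?_ ?_ h.hasDerivAt_y t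
  · simp [← rotCyc_mul_rotX, ← rotCyc_mul_rotZ, rotZ_zero]
  · intro s t
    rw [← map_mul]
    simp only [← rotCyc_mul_rotX, ← rotCyc_mul_rotZ, rotZ_add]
    congr 1; group

theorem map_rotZ (h : IsInfinitesimal ρ A B C) (t : ℝ) : ρ (rotZ t) = NormedSpace.exp (t • C) := by
  have : CompleteSpace (V →L[ℂ] V) := FiniteDimensional.complete ℂ _
  exact eq_exp_of_hasDerivAt_zero (γ := fun t => ρ (rotZ t)) (by simp [rotZ_zero])
    (by simp [rotZ_add]) h.hasDerivAt_z t

theorem map_rotZ_mul (h : IsInfinitesimal ρ A B C) (s : ℝ) :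
    ρ (rotZ s) * A * ρ (rotZ (-s)) = cos s • A + sin s • B := by
  have hcos : HasDerivAt cos 0 0 := by simpa using hasDerivAt_cos 0
  have hsin : HasDerivAt sin 1 0 := by simpa using hasDerivAt_sin 0
  set g : ℝ → SO 3 := fun t => rotZ s * rotX t * rotZ (-s) with hg
  have h1 : HasDerivAt (fun t => ρ (g t)) (ρ (rotZ s) * A * ρ (rotZ (-s))) 0 := by
    simp_rw [hg, map_mul]
    exact (h.hasDerivAt_x.const_mul _).mul_const _
  set a : ℝ → ℝ := fun t => arctan (cos s * sin t / cos t)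
  set b : ℝ → ℝ := fun t => arcsin (sin s * sin t)
  set c : ℝ → ℝ := fun t => arctan (-((1 - cos t) * cos s * sin s) /
    (cos s ^ 2 + cos t * sin s ^ 2))
  have ha0 : a 0 = 0 := by simp [a]
  have hb0 : b 0 = 0 := by simp [b]
  have hc0 : c 0 = 0 := by simp [c]
  have hrx : ρ (rotX 0) = 1 := by rw [h.map_rotX]; simp
  have hry : ρ (rotY 0) = 1 := by rw [h.map_rotY]; simp
  have hrz : ρ (rotZ 0) = 1 := by rw [h.map_rotZ]; simp
  have ha : HasDerivAt a (cos s) 0 := by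
    have := ((hsin.const_mul (cos s)).div hcos (by simp)).arctan
    simpa [a] using this
  have hb : HasDerivAt b (sin s) 0 := by
    have h' : HasDerivAt (fun t => sin s * sin t) (sin s) 0 := by
      simpa using hsin.const_mul (sin s)
    have := HasDerivAt.comp (h₂ := arcsin) (h := fun t => sin s * sin t) 0
      (hasDerivAt_arcsin (by simp) (by simp)) h'
    simpa [b, Function.comp_def] using this
  have hc : HasDerivAt c 0 0 := by
    have hd : cos s ^ 2 + cos 0 * sin s ^ 2 ≠ 0 := by simp
    have := (((((hcos.const_sub 1).mul_const (cos s)).mul_const (sin s)).neg).div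
      ((hcos.mul_const (sin s ^ 2)).const_add (cos s ^ 2)) hd).arctan
    simpa [c] using this
  have hcomp {γ : ℝ → SO 3} {X : V →L[ℂ] V} {u : ℝ → ℝ} {u' : ℝ}
      (hγ : HasDerivAt (fun t => ρ (γ t)) X 0) (hu : HasDerivAt u u' 0) (hu0 : u 0 = 0) :
      HasDerivAt (fun t => ρ (γ (u t))) (u' • X) 0 :=
    HasDerivAt.scomp (g₁ := fun t => ρ (γ t)) 0 (by rwa [hu0]) hu
  have h2 : HasDerivAt (fun t => ρ (rotX (a t)) * ρ (rotY (b t)) * ρ (rotZ (c t)))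
      (cos s • A + sin s • B) 0 := by
    have := ((hcomp h.hasDerivAt_x ha ha0).fun_mul (hcomp h.hasDerivAt_y hb hb0)).fun_mul
      (hcomp h.hasDerivAt_z hc hc0)
    simpa [ha0, hb0, hc0, hrx, hry, hrz] using this
  refine h1.unique (h2.congr_of_eventuallyEq ?_)
  have hc1 : ∀ᶠ t in 𝓝 (0 : ℝ), 0 < cos t :=
    continuous_cos.continuousAt.eventually_const_lt (by simp)
  filter_upwards [hc1] with t ht
  obtain ⟨e00, e01, e02, e12, e22⟩ := rotZ_mul_rotX_mul_entries s t
  have hpos : 0 < cos s ^ 2 + cos t * sin s ^ 2 := by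
    rcases eq_or_ne (sin s) 0 with hs | hs
    · have := cos_sq_add_sin_sq s
      rw [hs] at this ⊢
      nlinarith
    · positivity
  have := eq_rotX_mul_rotY_mul_rotZ (g := g t) (by rw [e00]; exact hpos) (by rw [e22]; exact ht)
  rw [this, map_mul, map_mul, e00, e01, e02, e12, e22, neg_neg]

theorem lie_z_x (h : IsInfinitesimal ρ A B C) : C * A - A * C = B := by
  have hcos : HasDerivAt cos 0 0 := by simpa using hasDerivAt_cos 0
  have hsin : HasDerivAt sin 1 0 := by simpa using hasDerivAt_sin 0
  have h1 : HasDerivAt (fun s : ℝ => cos s • A + sin s • B) B 0 := by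
    simpa using (hcos.smul_const A).fun_add (hsin.smul_const B)
  have hneg : HasDerivAt (fun s : ℝ => ρ (rotZ (-s))) (-C) 0 := by
    have := HasDerivAt.scomp (g₁ := fun t => ρ (rotZ t)) (h := fun s : ℝ => -s) (0 : ℝ)
      (by simpa using h.hasDerivAt_z) (hasDerivAt_neg 0)
    simpa [Function.comp_def] using this
  have h2 := (h.hasDerivAt_z.mul_const A).fun_mul hneg
  simp only [h.map_rotZ_mul, rotZ_zero, neg_zero, map_one] at h2
  have := h2.unique h1
  simpa [sub_eq_add_neg] using this

theorem lie_x_y (h : IsInfinitesimal ρ A B C) : A * B - B * A = C := by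
  have := congrArg (fun X => ρ rotCyc * X * ρ rotCyc⁻¹) h.lie_z_x
  simpa only [mul_sub, sub_mul, map_rotCyc_conj_mul, h.conj_x, h.conj_y, h.conj_z] using this

theorem lie_y_z (h : IsInfinitesimal ρ A B C) : B * C - C * B = A := by
  have := congrArg (fun X => ρ rotCyc * X * ρ rotCyc⁻¹) h.lie_x_y
  simpa only [mul_sub, sub_mul, map_rotCyc_conj_mul, h.conj_x, h.conj_y, h.conj_z] using this

end IsInfinitesimal

end LieAction

section ExpInvariant

variable {V : Type*} [NormedAddCommGroup V] [NormedSpace ℂ V] [FiniteDimensional ℂ V]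

theorem hasSum_exp_apply (X : V →L[ℂ] V) (w : V) :
    HasSum (fun k : ℕ => ((k.factorial : ℂ)⁻¹) • (X ^ k) w) (NormedSpace.exp X w) := by
  have : CompleteSpace (V →L[ℂ] V) := FiniteDimensional.complete ℂ _
  have h := NormedSpace.exp_series_hasSum_exp' (𝕂 := ℂ) X
  have h' := h.mapL (ContinuousLinearMap.apply ℂ V w)
  simpa using h'

theorem exp_apply_mem {W : Submodule ℂ V} {X : V →L[ℂ] V} (hX : ∀ w ∈ W, X w ∈ W) {w : V}
    (hw : w ∈ W) : NormedSpace.exp X w ∈ W := by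
  have hpow (k : ℕ) : (X ^ k) w ∈ W := by
    induction k with
    | zero => simpa using hw
    | succ k ih => rw [pow_succ']; exact hX _ ih
  exact W.closed_of_finiteDimensional.mem_of_tendsto (hasSum_exp_apply X w)
    (Filter.Eventually.of_forall fun s => W.sum_mem fun k _ => W.smul_mem _ (hpow k))

theorem exp_apply_eigenvector {X : V →L[ℂ] V} {c : ℂ} {w : V} (hw : X w = c • w) :
    NormedSpace.exp X w = Complex.exp c • w := by
  have hpow (k : ℕ) : (X ^ k) w = c ^ k • w := by
    induction k with
    | zero => simp
    | succ k ih =>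
      rw [pow_succ', mul_apply_eq_comp, ih, map_smul, hw, smul_smul, pow_succ]
  refine (hasSum_exp_apply X w).unique ?_
  simp_rw [hpow, smul_smul]
  have := (NormedSpace.exp_series_hasSum_exp' (𝕂 := ℂ) c).smul_const w
  simpa [Complex.exp_eq_exp_ℂ] using this

theorem derivative_apply_mem {γ : ℝ → V →L[ℂ] V} {X : V →L[ℂ] V} (h0 : γ 0 = 1)
    (hγ : HasDerivAt γ X 0) {W : Submodule ℂ V} (hW : ∀ t, ∀ w ∈ W, γ t w ∈ W) {w : V}
    (hw : w ∈ W) : X w ∈ W := by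
  have h : HasDerivAt (fun t => γ t w) (X w) 0 := by
    have := (((ContinuousLinearMap.apply ℂ V w).restrictScalars ℝ).hasFDerivAt
      (x := γ 0)).comp_hasDerivAt (0 : ℝ) hγ
    simpa [Function.comp_def] using this
  refine W.closed_of_finiteDimensional.mem_of_tendsto (hasDerivAt_iff_tendsto_slope.1 h)
    (Filter.Eventually.of_forall fun t => ?_)
  rw [slope_def_module, h0]
  have := W.smul_mem ((t - 0 : ℝ)⁻¹ : ℂ) (W.sub_mem (hW t w hw) hw)
  simpa [← Complex.coe_smul] using this

end ExpInvariant

section LieTriple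

attribute [local instance] LieRing.ofAssociativeRing

namespace IsInfinitesimal

variable {V : Type*} [NormedAddCommGroup V] [NormedSpace ℂ V] [FiniteDimensional ℂ V]
variable {ρ : SO 3 →* (V →L[ℂ] V)} {A B C : V →L[ℂ] V}

theorem apply_mem_of_invariant (h : IsInfinitesimal ρ A B C) {W : Submodule ℂ V}
    (hW : ∀ g, ∀ w ∈ W, ρ g w ∈ W) {w : V} (hw : w ∈ W) : A w ∈ W ∧ B w ∈ W ∧ C w ∈ W :=
  ⟨derivative_apply_mem (by simp [h.map_rotX]) h.hasDerivAt_x (fun _ => hW _) hw,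
    derivative_apply_mem (by simp [h.map_rotY]) h.hasDerivAt_y (fun _ => hW _) hw,
    derivative_apply_mem (by simp [h.map_rotZ]) h.hasDerivAt_z (fun _ => hW _) hw⟩

theorem invariant_of_apply_mem (h : IsInfinitesimal ρ A B C) {W : Submodule ℂ V}
    (hB : ∀ w ∈ W, B w ∈ W) (hC : ∀ w ∈ W, C w ∈ W) (g : SO 3) {w : V} (hw : w ∈ W) :
    ρ g w ∈ W := by
  have hsmul {X : V →L[ℂ] V} (hX : ∀ w ∈ W, X w ∈ W) (t : ℝ) : ∀ w ∈ W, (t • X) w ∈ W := by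
    intro w hw
    have := W.smul_mem (t : ℂ) (hX w hw)
    simpa using this
  obtain ⟨a, b, c, rfl⟩ := exists_euler g
  rw [map_mul, map_mul, h.map_rotZ, h.map_rotY, h.map_rotZ]
  exact exp_apply_mem (hsmul hC a) (exp_apply_mem (hsmul hB b) (exp_apply_mem (hsmul hC c) hw))

theorem isSl2Triple (h : IsInfinitesimal ρ A B C) (hC : C ≠ 0) :
    IsSl2Triple (L := Module.End ℂ V) (((2 * Complex.I) • C : V →L[ℂ] V) : V →ₗ[ℂ] V)
      ((A + Complex.I • B : V →L[ℂ] V) : V →ₗ[ℂ] V)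
      ((Complex.I • B - A : V →L[ℂ] V) : V →ₗ[ℂ] V) := by
  have hxy (w : V) : A (B w) - B (A w) = C w := DFunLike.congr_fun h.lie_x_y w
  have hyz (w : V) : B (C w) - C (B w) = A w := DFunLike.congr_fun h.lie_y_z w
  have hzx (w : V) : C (A w) - A (C w) = B w := DFunLike.congr_fun h.lie_z_x w
  refine ⟨?_, ?_, ?_, ?_⟩
  · intro h0
    refine hC (ContinuousLinearMap.ext fun w => ?_)
    simpa using LinearMap.congr_fun h0 w
  · ext w
    rw [Ring.lie_def]
    simp only [LinearMap.sub_apply, Module.End.mul_apply, ContinuousLinearMap.coe_coe,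
      _root_.add_apply, _root_.sub_apply, _root_.smul_apply, map_add, map_sub, map_smul]
    rw [← hxy]
    module
  · ext w
    rw [Ring.lie_def]
    simp only [LinearMap.sub_apply, Module.End.mul_apply, ContinuousLinearMap.coe_coe,
      _root_.add_apply, _root_.smul_apply, map_add, map_smul, LinearMap.smul_apply,
      sub_eq_iff_eq_add.1 (hzx w), sub_eq_iff_eq_add.1 (hyz w)]
    match_scalars <;> ring_nf; simp [Complex.I_sq]
  · ext w
    rw [Ring.lie_def]
    simp only [LinearMap.sub_apply, Module.End.mul_apply, ContinuousLinearMap.coe_coe,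
      _root_.sub_apply, _root_.smul_apply, map_sub, map_smul, LinearMap.smul_apply,
      LinearMap.neg_apply, sub_eq_iff_eq_add.1 (hzx w), sub_eq_iff_eq_add.1 (hyz w)]
    match_scalars <;> ring_nf; simp [Complex.I_sq]

end IsInfinitesimal

/-! ### Primitive vectors for `sl₂` -/

namespace IsSl2Triple.HasPrimitiveVectorWith

variable {V : Type*} [AddCommGroup V] [Module ℂ V]
  {h e f : Module.End ℂ V} {t : IsSl2Triple h e f} {v : V} {N : ℕ}

theorem h_lower (P : t.HasPrimitiveVectorWith v (N : ℂ))
    (j : ℕ) : h ((f ^ j) v) = ((N : ℂ) - 2 * j) • (f ^ j) v := by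
  simpa using P.lie_h_pow_toEnd_f j

theorem e_lower (P : t.HasPrimitiveVectorWith v (N : ℂ))
    (j : ℕ) : e ((f ^ (j + 1)) v) = (((j : ℂ) + 1) * (N - j)) • (f ^ j) v := by
  simpa using P.lie_e_pow_succ_toEnd_f j

theorem lower_ne_zero (P : t.HasPrimitiveVectorWith v (N : ℂ))
    {j : ℕ} (hj : j ≤ N) : (f ^ j) v ≠ 0 := by
  simpa using P.pow_toEnd_f_ne_zero_of_eq_nat rfl hj

theorem lower_eq_zero (P : t.HasPrimitiveVectorWith v (N : ℂ))
    [FiniteDimensional ℂ V] : (f ^ (N + 1)) v = 0 := by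
  simpa using P.pow_toEnd_f_eq_zero_of_eq_nat rfl

theorem linearIndependent_lower (P : t.HasPrimitiveVectorWith v (N : ℂ))
    : LinearIndependent ℂ fun j : Fin (N + 1) => (f ^ (j : ℕ)) v := by
  refine Module.End.eigenvectors_linearIndependent' h (fun j : Fin (N + 1) => (N : ℂ) - 2 * (j : ℕ))
    ?_ _ fun j => ⟨?_, P.lower_ne_zero (Nat.lt_succ_iff.1 j.2)⟩
  · intro i j hij
    simpa [Fin.ext_iff] using hij
  · rw [Module.End.mem_eigenspace_iff]
    exact P.h_lower j

/-- The span of the vectors obtained by lowering is stable under the triple. -/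
theorem lower_span_invariant (P : t.HasPrimitiveVectorWith v (N : ℂ))
    [FiniteDimensional ℂ V] {w : V}
    (hw : w ∈ Submodule.span ℂ (Set.range fun j : Fin (N + 1) => (f ^ (j : ℕ)) v)) :
    e w ∈ Submodule.span ℂ (Set.range fun j : Fin (N + 1) => (f ^ (j : ℕ)) v) ∧
    f w ∈ Submodule.span ℂ (Set.range fun j : Fin (N + 1) => (f ^ (j : ℕ)) v) ∧
    h w ∈ Submodule.span ℂ (Set.range fun j : Fin (N + 1) => (f ^ (j : ℕ)) v) := by
  set W := Submodule.span ℂ (Set.range fun j : Fin (N + 1) => (f ^ (j : ℕ)) v) with hW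
  have hmem (j : ℕ) (hj : j < N + 1) : (f ^ j) v ∈ W := Submodule.subset_span ⟨⟨j, hj⟩, rfl⟩
  have key : W ≤ W.comap e ⊓ (W.comap f ⊓ W.comap h) := by
    rw [hW, Submodule.span_le, ← hW]
    rintro _ ⟨⟨j, hj⟩, rfl⟩
    refine ⟨?_, ?_, ?_⟩
    · change e ((f ^ j) v) ∈ W
      cases j with
      | zero =>
        have : e v = 0 := P.lie_e
        simp [this]
      | succ j =>
        rw [P.e_lower]
        exact W.smul_mem _ (hmem j (by omega))
    · change f ((f ^ j) v) ∈ W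
      rw [← Module.End.mul_apply, ← pow_succ']
      rcases (Nat.lt_succ_iff.1 hj).lt_or_eq with hlt | rfl
      · exact hmem _ (by omega)
      · rw [P.lower_eq_zero]; exact W.zero_mem
    · change h ((f ^ j) v) ∈ W
      rw [P.h_lower]
      exact W.smul_mem _ (hmem j hj)
  exact key hw

/-- A nonzero subspace of the span of the vectors obtained by lowering that is stable under
raising and lowering is the whole span. -/
theorem lower_span_le (P : t.HasPrimitiveVectorWith v (N : ℂ))
    {U : Submodule ℂ V}
    (hU : U ≤ Submodule.span ℂ (Set.range fun j : Fin (N + 1) => (f ^ (j : ℕ)) v)) (h0 : U ≠ ⊥)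
    (he : ∀ u ∈ U, e u ∈ U) (hf : ∀ u ∈ U, f u ∈ U) :
    Submodule.span ℂ (Set.range fun j : Fin (N + 1) => (f ^ (j : ℕ)) v) ≤ U := by
  have key (k : ℕ) (hk : k ≤ N) (c : ℕ → ℂ)
      (hc : ∑ j ∈ Finset.range (k + 1), c j • (f ^ j) v ∈ U)
      (hne : ∃ j ∈ Finset.range (k + 1), c j ≠ 0) : v ∈ U := by
    induction k generalizing c with
    | zero =>
      obtain ⟨j, hj, hj0⟩ := hne
      simp at hj
      subst hj
      exact (U.smul_mem_iff hj0).1 (by simpa using hc)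
    | succ k ih =>
      by_cases hlow : ∃ j ∈ Finset.range (k + 1), c (j + 1) ≠ 0
      · obtain ⟨j, hj, hj0⟩ := hlow
        refine ih (by omega) (fun j => c (j + 1) * ((j + 1) * (N - j))) ?_ ⟨j, hj, ?_⟩
        · have := he _ hc
          rw [Finset.sum_range_succ', map_add, map_sum] at this
          have hev : e v = 0 := P.lie_e
          simpa [P.e_lower, smul_smul, hev] using this
        · have hjk := Finset.mem_range.1 hj
          refine mul_ne_zero hj0 (mul_ne_zero (by exact_mod_cast j.succ_ne_zero) ?_)
          rw [sub_ne_zero]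
          exact_mod_cast (by omega : N ≠ j)
      · push Not at hlow
        rw [Finset.sum_range_succ', Finset.sum_eq_zero fun j hj => by rw [hlow j hj, zero_smul]]
          at hc
        have hc0 : c 0 ≠ 0 := by
          obtain ⟨j, hj, hj0⟩ := hne
          cases j with
          | zero => exact hj0
          | succ j => exact absurd (hlow j (by simpa using hj)) hj0
        exact (U.smul_mem_iff hc0).1 (by simpa using hc)
  obtain ⟨u, huU, hu0⟩ := U.exists_mem_ne_zero_of_ne_bot h0
  obtain ⟨c, rfl⟩ := (Submodule.mem_span_range_iff_exists_fun ℂ).1 (hU huU)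
  have hv : v ∈ U := by
    refine key N le_rfl (fun j => if hj : j < N + 1 then c ⟨j, hj⟩ else 0) ?_ ?_
    · rw [Finset.sum_range]
      simp only [Fin.is_lt, dite_true]
      exact huU
    · by_contra! hall
      refine hu0 (Finset.sum_eq_zero fun j _ => ?_)
      have := hall j (Finset.mem_range.2 j.2)
      simp only [Fin.is_lt, dite_true] at this
      rw [this, zero_smul]
  rw [Submodule.span_le]
  rintro _ ⟨⟨j, hj⟩, rfl⟩
  change (f ^ j) v ∈ U
  clear hj
  induction j with
  | zero => simpa using hv
  | succ j ih => rw [pow_succ', Module.End.mul_apply]; exact hf _ ih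

end IsSl2Triple.HasPrimitiveVectorWith

namespace IsInfinitesimal

variable {V : Type*} [NormedAddCommGroup V] [NormedSpace ℂ V] [FiniteDimensional ℂ V]
variable {ρ : SO 3 →* (V →L[ℂ] V)} {A B C : V →L[ℂ] V}
variable {t : IsSl2Triple (L := Module.End ℂ V) (((2 * Complex.I) • C : V →L[ℂ] V) : V →ₗ[ℂ] V)
      ((A + Complex.I • B : V →L[ℂ] V) : V →ₗ[ℂ] V)
      ((Complex.I • B - A : V →L[ℂ] V) : V →ₗ[ℂ] V)} {v : V} {N : ℕ}

/-- The subspace generated by a primitive vector is stable under the group. -/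
theorem lower_span_invariant (h : IsInfinitesimal ρ A B C)
    (P : t.HasPrimitiveVectorWith v (N : ℂ)) (g : SO 3) {w : V}
    (hw : w ∈ Submodule.span ℂ (Set.range fun j : Fin (N + 1) =>
      (((Complex.I • B - A : V →L[ℂ] V) : V →ₗ[ℂ] V) ^ (j : ℕ)) v)) :
    ρ g w ∈ Submodule.span ℂ (Set.range fun j : Fin (N + 1) =>
      (((Complex.I • B - A : V →L[ℂ] V) : V →ₗ[ℂ] V) ^ (j : ℕ)) v) := by
  refine h.invariant_of_apply_mem (fun w hw => ?_) (fun w hw => ?_) g hw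
  · obtain ⟨h1, h2, -⟩ := P.lower_span_invariant hw
    have h3 := Submodule.smul_mem _ (-(Complex.I / 2)) (Submodule.add_mem _ h1 h2)
    convert h3 using 1
    simp only [ContinuousLinearMap.coe_coe, _root_.add_apply, _root_.sub_apply, _root_.smul_apply]
    match_scalars <;> ring_nf
    simp [Complex.I_sq]
  · obtain ⟨-, -, h1⟩ := P.lower_span_invariant hw
    have h3 := Submodule.smul_mem _ (-(Complex.I / 2)) h1
    convert h3 using 1
    simp only [ContinuousLinearMap.coe_coe, _root_.smul_apply, smul_smul]
    match_scalars
    ring_nf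
    simp [Complex.I_sq]

/-- The subspace generated by a primitive vector has no proper nonzero stable subspace. -/
theorem eq_lower_span (h : IsInfinitesimal ρ A B C)
    (P : t.HasPrimitiveVectorWith v (N : ℂ)) {U : Submodule ℂ V}
    (hU : U ≤ Submodule.span ℂ (Set.range fun j : Fin (N + 1) =>
      (((Complex.I • B - A : V →L[ℂ] V) : V →ₗ[ℂ] V) ^ (j : ℕ)) v)) (h0 : U ≠ ⊥)
    (hinv : ∀ g, ∀ u ∈ U, ρ g u ∈ U) :
    U = Submodule.span ℂ (Set.range fun j : Fin (N + 1) =>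
      (((Complex.I • B - A : V →L[ℂ] V) : V →ₗ[ℂ] V) ^ (j : ℕ)) v) := by
  refine le_antisymm hU (P.lower_span_le hU h0 (fun u hu => ?_) (fun u hu => ?_))
  · obtain ⟨h1, h2, -⟩ := h.apply_mem_of_invariant hinv hu
    exact U.add_mem h1 (U.smul_mem _ h2)
  · obtain ⟨h1, h2, -⟩ := h.apply_mem_of_invariant hinv hu
    exact U.sub_mem (U.smul_mem _ h2) h1

theorem ne_zero_of_irreducible (h : IsInfinitesimal ρ A B C)
    (hirr : ∀ W : Submodule ℂ V, (∀ g, ∀ w ∈ W, ρ g w ∈ W) → W = ⊥ ∨ W = ⊤)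
    (hdim : 1 < Module.finrank ℂ V) : C ≠ 0 := by
  intro hC
  have hA : A = 0 := by rw [← h.conj_z, hC]; simp
  have hB : B = 0 := by rw [← h.conj_x, hA]; simp
  have : Nontrivial V := Module.finrank_pos_iff.1 (by omega : 0 < Module.finrank ℂ V)
  obtain ⟨w, hw⟩ := exists_ne (0 : V)
  rcases hirr (Submodule.span ℂ {w}) (fun g u hu => h.invariant_of_apply_mem
    (by simp [hB]) (by simp [hC]) g hu) with h' | h'
  · exact hw (Submodule.span_singleton_eq_bot.1 h')
  · have := finrank_span_singleton (K := ℂ) hw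
    rw [h', finrank_top] at this
    omega

/-- An irreducible representation has a basis of weight vectors. -/
theorem exists_basis (h : IsInfinitesimal ρ A B C)
    (hirr : ∀ W : Submodule ℂ V, (∀ g, ∀ w ∈ W, ρ g w ∈ W) → W = ⊥ ∨ W = ⊤)
    (hN : 1 ≤ N) (hdim : Module.finrank ℂ V = N + 1) :
    ∃ b : Module.Basis (Fin (N + 1)) ℂ V,
      ∀ j, C (b j) = ((((j : ℕ) : ℂ) - N / 2) * Complex.I) • b j := by
  have hC : C ≠ 0 := h.ne_zero_of_irreducible hirr (by omega)
  have t := h.isSl2Triple hC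
  have : Nontrivial V := Module.finrank_pos_iff.1 (by omega : 0 < Module.finrank ℂ V)
  obtain ⟨μ, v, hv, P⟩ := t.exists_hasPrimitiveVectorWith (R := ℂ) (M := V)
  obtain ⟨M, rfl⟩ := P.exists_nat
  have htop := (hirr _ fun g w => h.lower_span_invariant P g).resolve_left (by
    intro hbot
    rw [Submodule.span_eq_bot] at hbot
    exact hv (by simpa using hbot _ ⟨0, rfl⟩))
  have hcard := finrank_span_eq_card P.linearIndependent_lower
  rw [htop, finrank_top, hdim, Fintype.card_fin] at hcard
  obtain rfl : N = M := by omega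
  refine ⟨Module.Basis.mk P.linearIndependent_lower htop.ge, fun j => ?_⟩
  have h1 := P.h_lower j
  rw [Module.Basis.mk_apply]
  have h2 := congrArg (fun x => (-(Complex.I / 2)) • x) h1
  simp only [ContinuousLinearMap.coe_coe, _root_.smul_apply, smul_smul] at h2
  convert h2 using 1
  · have : -(Complex.I / 2) * (2 * Complex.I) = 1 := by
      linear_combination -Complex.I_mul_I
    rw [this, one_smul]
  · congr 1
    ring

theorem trace_map_rotZ (h : IsInfinitesimal ρ A B C)
    (hirr : ∀ W : Submodule ℂ V, (∀ g, ∀ w ∈ W, ρ g w ∈ W) → W = ⊥ ∨ W = ⊤)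
    (hN : 1 ≤ N) (hdim : Module.finrank ℂ V = N + 1) (θ : ℝ) :
    LinearMap.trace ℂ V (ρ (rotZ θ) : V →ₗ[ℂ] V) =
      ∑ j ∈ Finset.range (N + 1), Complex.exp (((j : ℂ) - N / 2) * θ * Complex.I) := by
  obtain ⟨b, hb⟩ := h.exists_basis hirr hN hdim
  rw [LinearMap.trace_eq_matrix_trace ℂ b, Matrix.trace, Finset.sum_range]
  refine Finset.sum_congr rfl fun j _ => ?_
  have h1 : ρ (rotZ θ) (b j) = Complex.exp ((((j : ℕ) : ℂ) - N / 2) * θ * Complex.I) • b j := by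
    rw [h.map_rotZ]
    refine exp_apply_eigenvector ?_
    rw [_root_.smul_apply, hb, ← Complex.coe_smul, smul_smul]
    congr 1
    ring
  rw [Matrix.diag_apply, LinearMap.toMatrix_apply, ContinuousLinearMap.coe_coe, h1]
  simp

end IsInfinitesimal

end LieTriple

/-! ### Characters of irreducible representations -/

/-- The continuous linear operators given by a homomorphism into `SO(m)`. -/
noncomputable def complexCLM {m : ℕ} (ρ : SO 3 →* SO m) :
    SO 3 →* ((Fin m → ℂ) →L[ℂ] (Fin m → ℂ)) where
  toFun g := LinearMap.toContinuousLinearMap (complexRep ρ g)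
  map_one' := by ext; simp
  map_mul' g g' := by ext; simp

theorem continuous_complexCLM {m : ℕ} {ρ : SO 3 →* SO m} (hρ : Continuous ρ) :
    Continuous (complexCLM ρ) := by
  have h1 : Continuous fun g : SO 3 =>
      ((ρ g : Matrix (Fin m) (Fin m) ℝ).map Complex.ofRealHom) :=
    (continuous_subtype_val.comp hρ).matrix_map Complex.continuous_ofReal
  have h2 : Continuous ((LinearMap.toContinuousLinearMap (𝕜 := ℂ) (E := Fin m → ℂ)
      (F' := Fin m → ℂ)).toLinearMap ∘ₗ (Matrix.toLin' (R := ℂ) (m := Fin m) (n := Fin m)).toLinearMap) :=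
    LinearMap.continuous_of_finiteDimensional _
  exact h2.comp h1

theorem eq_bot_or_eq_top_of_isIrreducible {m : ℕ} {ρ : SO 3 →* SO m}
    (hρ : (complexRep ρ).IsIrreducible) (W : Submodule ℂ (Fin m → ℂ))
    (hW : ∀ g, ∀ w ∈ W, complexCLM ρ g w ∈ W) : W = ⊥ ∨ W = ⊤ := by
  rcases hρ.eq_bot_or_eq_top (⟨W, fun g w hw => hW g w hw⟩ : Subrepresentation (complexRep ρ))
    with h | h
  · exact Or.inl (congrArg Subrepresentation.toSubmodule h)
  · exact Or.inr (congrArg Subrepresentation.toSubmodule h)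

/-- The character of an irreducible representation of `SO(3)` of dimension `2n + 1`. -/
theorem IsIrrepOfSO3.trace_rotZ {n : ℕ} (hn : 1 ≤ n) {ρ : SO 3 →* SO (2 * n + 1)}
    (hρ : IsIrrepOfSO3 ρ) (θ : ℝ) :
    ((trace (ρ (rotZ θ) : Matrix (Fin (2 * n + 1)) (Fin (2 * n + 1)) ℝ) : ℝ) : ℂ) =
      ∑ j ∈ Finset.range (2 * n + 1), Complex.exp (((j : ℂ) - n) * θ * Complex.I) := by
  obtain ⟨A, B, C, h⟩ := exists_isInfinitesimal (continuous_complexCLM hρ.1)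
  have := h.trace_map_rotZ (N := 2 * n) (eq_bot_or_eq_top_of_isIrreducible hρ.2) (by omega)
    (by simp) θ
  have h2 : LinearMap.trace ℂ (Fin (2 * n + 1) → ℂ)
      (complexCLM ρ (rotZ θ) : (Fin (2 * n + 1) → ℂ) →ₗ[ℂ] (Fin (2 * n + 1) → ℂ)) =
      trace ((ρ (rotZ θ) : Matrix (Fin (2 * n + 1)) (Fin (2 * n + 1)) ℝ).map Complex.ofRealHom) :=
    Matrix.trace_toLin'_eq _
  rw [h2] at this
  have h3 : ((trace (ρ (rotZ θ) : Matrix (Fin (2 * n + 1)) (Fin (2 * n + 1)) ℝ) : ℝ) : ℂ) =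
      trace ((ρ (rotZ θ) : Matrix (Fin (2 * n + 1)) (Fin (2 * n + 1)) ℝ).map Complex.ofRealHom) := by
    simp [Matrix.trace]
  rw [h3, this]
  simp

theorem IsIrrepOfSO3.trace_rotZ_eq_sum_cos {n : ℕ} (hn : 1 ≤ n) {ρ : SO 3 →* SO (2 * n + 1)}
    (hρ : IsIrrepOfSO3 ρ) (θ : ℝ) :
    trace (ρ (rotZ θ) : Matrix (Fin (2 * n + 1)) (Fin (2 * n + 1)) ℝ) =
      ∑ j ∈ Finset.range (2 * n + 1), cos (((j : ℝ) - n) * θ) := by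
  have h := congrArg Complex.re (hρ.trace_rotZ hn θ)
  rw [Complex.ofReal_re, Complex.re_sum] at h
  rw [h]
  refine Finset.sum_congr rfl fun j _ => ?_
  rw [← Complex.exp_ofReal_mul_I_re]
  simp

/-! ### Orthogonal representations with the same character -/

section SameCharacter

variable {Γ : Type*} [Group Γ]
variable {E : Type*} [NormedAddCommGroup E] [InnerProductSpace ℝ E]
variable {F : Type*} [NormedAddCommGroup F] [InnerProductSpace ℝ F]

/-- A representation on an inner product space is orthogonal if it preserves inner products. -/
def Representation.IsOrthogonal (ρ : Representation ℝ Γ E) : Prop :=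
  ∀ g x y, ⟪ρ g x, ρ g y⟫_ℝ = ⟪x, y⟫_ℝ

theorem Representation.IsOrthogonal.inner_left {ρ : Representation ℝ Γ E} (hρ : ρ.IsOrthogonal)
    (g : Γ) (x y : E) : ⟪ρ g x, y⟫_ℝ = ⟪x, ρ g⁻¹ y⟫_ℝ := by
  rw [← hρ g x (ρ g⁻¹ y), ← Module.End.mul_apply, ← map_mul, mul_inv_cancel, map_one,
    Module.End.one_apply]

theorem Representation.IsOrthogonal.orthogonal_invariant {ρ : Representation ℝ Γ E}
    (hρ : ρ.IsOrthogonal) {W : Submodule ℝ E} (hW : ∀ g, ∀ w ∈ W, ρ g w ∈ W) (g : Γ) :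
    ∀ x ∈ Wᗮ, ρ g x ∈ Wᗮ := by
  intro x hx
  rw [Submodule.mem_orthogonal'] at hx ⊢
  intro w hw
  rw [hρ.inner_left]
  exact hx _ (hW _ w hw)

theorem eq_zero_of_intertwining_eq_zero {ρ : Representation ℝ Γ E} {σ : Representation ℝ Γ F}
    (hzero : ∀ T : E →ₗ[ℝ] F, (∀ g x, T (ρ g x) = σ g (T x)) → T = 0)
    (φ : ρ.asModule →ₗ[ℝ[Γ]] σ.asModule) : φ = 0 := by
  let T : E →ₗ[ℝ] F :=
    { toFun x := σ.asModuleEquiv (φ (ρ.asModuleEquiv.symm x))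
      map_add' x y := by simp
      map_smul' c x := by
        rw [Representation.asModuleEquiv_symm_map_smul, map_smul,
          Representation.asModuleEquiv_map_smul, AlgHom.commutes]
        rfl }
  have hT := hzero T fun g x => by
    change σ.asModuleEquiv (φ (ρ.asModuleEquiv.symm (ρ g x))) =
      σ g (σ.asModuleEquiv (φ (ρ.asModuleEquiv.symm x)))
    rw [Representation.asModuleEquiv_symm_map_rho, map_smul, Representation.asModuleEquiv_map_smul,
      Representation.asAlgebraHom_of]
  ext x
  have h := LinearMap.congr_fun hT (ρ.asModuleEquiv x)
  change σ.asModuleEquiv (φ (ρ.asModuleEquiv.symm (ρ.asModuleEquiv x))) = 0 at h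
  rwa [LinearEquiv.symm_apply_apply, LinearEquiv.map_eq_zero_iff] at h

theorem isSemisimpleModule_prod {R M N : Type*} [Ring R] [AddCommGroup M] [AddCommGroup N]
    [Module R M] [Module R N] [IsSemisimpleModule R M] [IsSemisimpleModule R N] :
    IsSemisimpleModule R (M × N) := by
  have h1 := IsSemisimpleModule.range (LinearMap.inl R M N)
  have h2 := IsSemisimpleModule.range (LinearMap.inr R M N)
  have h := IsSemisimpleModule.sup h1 h2
  rw [LinearMap.sup_range_inl_inr] at h
  exact IsSemisimpleModule.congr Submodule.topEquiv.symm

theorem trace_asAlgebraHom_eq {ρ : Representation ℝ Γ E} {σ : Representation ℝ Γ F}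
    (htr : ∀ g, LinearMap.trace ℝ E (ρ g) = LinearMap.trace ℝ F (σ g)) (r : ℝ[Γ]) :
    LinearMap.trace ℝ E (ρ.asAlgebraHom r) = LinearMap.trace ℝ F (σ.asAlgebraHom r) := by
  induction r using MonoidAlgebra.induction_linear with
  | zero => simp
  | add x y hx hy => simp [hx, hy]
  | single g a => simp [htr]

variable [FiniteDimensional ℝ E]

theorem Representation.IsOrthogonal.isSemisimpleModule {ρ : Representation ℝ Γ E}
    (hρ : ρ.IsOrthogonal) : IsSemisimpleModule ℝ[Γ] ρ.asModule := by
  rw [← Representation.isSemisimpleRepresentation_iff_isSemisimpleModule_asModule]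
  refine ⟨fun W => ⟨⟨W.toSubmoduleᗮ, fun g x hx => hρ.orthogonal_invariant
    (fun g w hw => W.apply_mem_toSubmodule g hw) g x hx⟩, ?_⟩⟩
  have h := Submodule.isCompl_orthogonal (K := W.toSubmodule)
  constructor
  · rw [disjoint_iff]
    exact Subrepresentation.toSubmodule_injective h.inf_eq_bot
  · rw [codisjoint_iff]
    exact Subrepresentation.toSubmodule_injective h.sup_eq_top

theorem trace_eq_trace_restrict_add {f : E →ₗ[ℝ] E} {W : Submodule ℝ E}
    (h1 : ∀ x ∈ W, f x ∈ W) (h2 : ∀ x ∈ Wᗮ, f x ∈ Wᗮ) :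
    LinearMap.trace ℝ E f =
      LinearMap.trace ℝ W (f.restrict h1) + LinearMap.trace ℝ Wᗮ (f.restrict h2) := by
  rw [← LinearMap.trace_prodMap', ← LinearMap.trace_conj' _
    (Submodule.prodEquivOfIsCompl W Wᗮ W.isCompl_orthogonal)]
  congr 1
  refine LinearMap.ext fun x => ?_
  obtain ⟨y, rfl⟩ := (Submodule.prodEquivOfIsCompl W Wᗮ W.isCompl_orthogonal).surjective x
  simp [LinearEquiv.conj_apply]

variable [FiniteDimensional ℝ F]

/-- Orthogonal representations with the same character have a nonzero intertwining operator. -/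
theorem exists_intertwining_ne_zero [Nontrivial E] {ρ : Representation ℝ Γ E}
    {σ : Representation ℝ Γ F} (hρ : ρ.IsOrthogonal) (hσ : σ.IsOrthogonal)
    (htr : ∀ g, LinearMap.trace ℝ E (ρ g) = LinearMap.trace ℝ F (σ g)) :
    ∃ T : E →ₗ[ℝ] F, T ≠ 0 ∧ ∀ g x, T (ρ g x) = σ g (T x) := by
  by_contra! hno
  have hzero (T : E →ₗ[ℝ] F) (hT : ∀ g x, T (ρ g x) = σ g (T x)) : T = 0 := by
    by_contra h0
    obtain ⟨g, x, h⟩ := hno T h0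
    exact h (hT g x)
  have hzero' (T : F →ₗ[ℝ] E) (hT : ∀ g x, T (σ g x) = ρ g (T x)) : T = 0 := by
    have := hzero T.adjoint fun g x => by
      refine ext_inner_right ℝ fun y => ?_
      rw [LinearMap.adjoint_inner_left, hρ.inner_left, hσ.inner_left,
        LinearMap.adjoint_inner_left, hT]
    rw [← LinearMap.adjoint_adjoint T, this, map_zero]
  have := hρ.isSemisimpleModule
  have := hσ.isSemisimpleModule
  have := isSemisimpleModule_prod (R := ℝ[Γ]) (M := ρ.asModule) (N := σ.asModule)
  let M := ρ.asModule
  let N := σ.asModule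
  let p : Module.End (Module.End ℝ[Γ] (M × N)) (M × N) :=
    { toFun m := (m.1, 0)
      map_add' x y := by simp
      map_smul' T m := by
        have h1 : LinearMap.snd ℝ[Γ] M N ∘ₗ T ∘ₗ LinearMap.inl ℝ[Γ] M N = 0 :=
          eq_zero_of_intertwining_eq_zero hzero _
        have h2 : LinearMap.fst ℝ[Γ] M N ∘ₗ T ∘ₗ LinearMap.inr ℝ[Γ] M N = 0 :=
          eq_zero_of_intertwining_eq_zero hzero' _
        have h1' : (T (m.1, 0)).2 = 0 := LinearMap.congr_fun h1 m.1
        have h2' : (T (0, m.2)).1 = 0 := LinearMap.congr_fun h2 m.2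
        have hm : T m = T (m.1, 0) + T (0, m.2) := by rw [← map_add]; simp
        ext
        · simp [hm, h2']
        · simp [h1'] }
  let bE := Module.finBasis ℝ E
  let bF := Module.finBasis ℝ F
  classical
  obtain ⟨r, hr⟩ := jacobson_density p
    (Finset.univ.image (fun i => ((ρ.asModuleEquiv.symm (bE i), 0) : M × N)) ∪
      Finset.univ.image (fun i => ((0, σ.asModuleEquiv.symm (bF i)) : M × N)))
  have hE : ρ.asAlgebraHom r = 1 := bE.ext fun i => by
    have h := congrArg Prod.fst (hr (ρ.asModuleEquiv.symm (bE i), 0) (by simp))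
    have h' := congrArg ρ.asModuleEquiv h
    change ρ.asModuleEquiv (ρ.asModuleEquiv.symm (bE i)) =
      ρ.asModuleEquiv (r • ρ.asModuleEquiv.symm (bE i)) at h'
    rw [Representation.asModuleEquiv_map_smul, LinearEquiv.apply_symm_apply] at h'
    exact h'.symm
  have hF : σ.asAlgebraHom r = 0 := bF.ext fun i => by
    have h := congrArg Prod.snd (hr (0, σ.asModuleEquiv.symm (bF i)) (by simp))
    have h' := congrArg σ.asModuleEquiv h
    change σ.asModuleEquiv 0 = σ.asModuleEquiv (r • σ.asModuleEquiv.symm (bF i)) at h'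
    rw [Representation.asModuleEquiv_map_smul, LinearEquiv.apply_symm_apply, map_zero] at h'
    exact h'.symm
  have h := trace_asAlgebraHom_eq htr r
  rw [hE, hF, LinearMap.trace_one, map_zero] at h
  exact Module.finrank_pos.ne' (Nat.cast_eq_zero.1 h : Module.finrank ℝ E = 0)

/-- An intertwining operator is a multiple of an isometry on some nonzero stable subspace. -/
theorem exists_scaled_isometry {ρ : Representation ℝ Γ E} {σ : Representation ℝ Γ F}
    (hρ : ρ.IsOrthogonal) (hσ : σ.IsOrthogonal) {T : E →ₗ[ℝ] F} (h0 : T ≠ 0)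
    (hT : ∀ g x, T (ρ g x) = σ g (T x)) :
    ∃ (c : ℝ) (W : Submodule ℝ E), 0 < c ∧ W ≠ ⊥ ∧ (∀ g, ∀ w ∈ W, ρ g w ∈ W) ∧
      ∀ w ∈ W, ‖T w‖ = c * ‖w‖ := by
  set S : E →ₗ[ℝ] E := T.adjoint ∘ₗ T with hS
  have hsym : S.IsSymmetric := fun x y => by
    simp [hS, LinearMap.adjoint_inner_left, LinearMap.adjoint_inner_right]
  have hcomm (g : Γ) (x : E) : S (ρ g x) = ρ g (S x) := by
    refine ext_inner_right ℝ fun y => ?_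
    simp only [hS, LinearMap.comp_apply]
    rw [LinearMap.adjoint_inner_left, hT, hσ.inner_left, hρ.inner_left, ← hT,
      LinearMap.adjoint_inner_left]
  have hin (x : E) : ⟪S x, x⟫_ℝ = ‖T x‖ ^ 2 := by
    simp [hS, LinearMap.adjoint_inner_left]
  obtain ⟨i, hi⟩ : ∃ i, hsym.eigenvalues rfl i ≠ 0 := by
    by_contra! hall
    refine h0 (LinearMap.ext fun x => ?_)
    have hSz : S = 0 := (hsym.eigenvectorBasis rfl).toBasis.ext fun i => by
      simp [hsym.apply_eigenvectorBasis, hall]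
    have := hin x
    simpa [hSz] using this.symm
  set l := hsym.eigenvalues rfl i
  have hnorm (w : E) (hw : w ∈ Module.End.eigenspace S l) : ‖T w‖ ^ 2 = l * ‖w‖ ^ 2 := by
    rw [← hin, Module.End.mem_eigenspace_iff.1 hw, inner_smul_left]
    simp
  have hev : hsym.eigenvectorBasis rfl i ∈ Module.End.eigenspace S l := by
    rw [Module.End.mem_eigenspace_iff]
    exact hsym.apply_eigenvectorBasis rfl i
  have hl : 0 < l := by
    have := hnorm _ hev
    rw [(hsym.eigenvectorBasis rfl).norm_eq_one] at this
    have h' : 0 ≤ l := by nlinarith [sq_nonneg ‖T (hsym.eigenvectorBasis rfl i)‖]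
    exact lt_of_le_of_ne h' hi.symm
  refine ⟨√l, Module.End.eigenspace S l, sqrt_pos.2 hl, ?_, ?_, ?_⟩
  · intro hbot
    rw [hbot, Submodule.mem_bot] at hev
    have := (hsym.eigenvectorBasis rfl).norm_eq_one i
    rw [hev, norm_zero] at this
    exact zero_ne_one this
  · intro g w hw
    rw [Module.End.mem_eigenspace_iff] at hw ⊢
    rw [hcomm, hw, map_smul]
  · intro w hw
    rw [← sq_eq_sq₀ (norm_nonneg _) (by positivity), hnorm w hw, mul_pow, sq_sqrt hl.le]

end SameCharacter

/-- Orthogonal representations with the same character are isometrically equivalent. -/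
theorem exists_isometry_of_trace_eq {Γ : Type*} [Group Γ] (d : ℕ) :
    ∀ {E : Type} [NormedAddCommGroup E] [InnerProductSpace ℝ E] [FiniteDimensional ℝ E]
    {F : Type} [NormedAddCommGroup F] [InnerProductSpace ℝ F] [FiniteDimensional ℝ F]
    {ρ : Representation ℝ Γ E} {σ : Representation ℝ Γ F}, Module.finrank ℝ E = d →
    ρ.IsOrthogonal → σ.IsOrthogonal →
    (∀ g, LinearMap.trace ℝ E (ρ g) = LinearMap.trace ℝ F (σ g)) →
    ∃ U : E →ₗᵢ[ℝ] F, ∀ g x, U (ρ g x) = σ g (U x) := by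
  induction d using Nat.strong_induction_on with
  | _ d ih =>
  intro E _ _ _ F _ _ _ ρ σ hd hρ hσ htr
  rcases subsingleton_or_nontrivial E with hE | hE
  · exact ⟨⟨0, fun x => by simp [Subsingleton.elim x 0]⟩, fun g x => by simp⟩
  obtain ⟨T, hT0, hT⟩ := exists_intertwining_ne_zero hρ hσ htr
  obtain ⟨c, W, hc, hW0, hW, hnorm⟩ := exists_scaled_isometry hρ hσ hT0 hT
  let U₀ : W →ₗᵢ[ℝ] F := ⟨c⁻¹ • T ∘ₗ W.subtype, fun w => by
    simp [norm_smul, hnorm w w.2, abs_of_pos hc, hc.ne']⟩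
  have hU₀ (g : Γ) (w : W) : U₀ ⟨ρ g w, hW g w w.2⟩ = σ g (U₀ w) := by
    change c⁻¹ • T (ρ g w) = σ g (c⁻¹ • T w)
    rw [hT, map_smul]
  let W' : Submodule ℝ F := LinearMap.range U₀.toLinearMap
  have hW' : ∀ g, ∀ w ∈ W', σ g w ∈ W' := by
    rintro g _ ⟨w, rfl⟩
    exact ⟨⟨ρ g w, hW g w w.2⟩, hU₀ g w⟩
  have hWo := hρ.orthogonal_invariant hW
  have hWo' := hσ.orthogonal_invariant hW'
  let Q : Subrepresentation ρ := ⟨Wᗮ, fun g x hx => hWo g x hx⟩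
  let Q' : Subrepresentation σ := ⟨W'ᗮ, fun g x hx => hWo' g x hx⟩
  have hlt : Module.finrank ℝ Wᗮ < d := by
    have := W.finrank_add_finrank_orthogonal
    have := Submodule.one_le_finrank_iff.2 hW0
    omega
  obtain ⟨U₁, hU₁⟩ := ih _ hlt (ρ := Q.toRepresentation) (σ := Q'.toRepresentation) rfl
    (fun g x y => hρ g x y) (fun g x y => hσ g x y) (by
      intro g
      have h1 := htr g
      rw [trace_eq_trace_restrict_add (hW g) (hWo g),
        trace_eq_trace_restrict_add (hW' g) (hWo' g)] at h1
      have h2 : LinearMap.trace ℝ W' ((σ g).restrict (hW' g)) =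
          LinearMap.trace ℝ W ((ρ g).restrict (hW g)) := by
        rw [← LinearMap.trace_conj' _ (LinearEquiv.ofInjective U₀.toLinearMap U₀.injective)]
        congr 1
        refine LinearMap.ext fun x => ?_
        obtain ⟨w, rfl⟩ := (LinearEquiv.ofInjective U₀.toLinearMap U₀.injective).surjective x
        refine Subtype.ext ?_
        rw [LinearEquiv.conj_apply_apply, LinearEquiv.symm_apply_apply]
        exact (hU₀ g w).symm
      rw [h2] at h1
      exact add_left_cancel h1)
  let e := Submodule.prodEquivOfIsCompl W Wᗮ W.isCompl_orthogonal
  let L : E →ₗ[ℝ] F :=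
    (U₀.toLinearMap.coprod (W'ᗮ.subtype ∘ₗ U₁.toLinearMap)) ∘ₗ e.symm.toLinearMap
  have hL (a : W) (b : Wᗮ) : L (a + b) = U₀ a + U₁ b := by
    have : (a + b : E) = e (a, b) := rfl
    simp [L, this]
  refine ⟨⟨L, fun x => ?_⟩, fun g x => ?_⟩
  · obtain ⟨⟨a, b⟩, rfl⟩ := e.surjective x
    change ‖L (a + b)‖ = ‖(a + b : E)‖
    have h1 : ⟪(a : E), (b : E)⟫_ℝ = 0 := Submodule.inner_right_of_mem_orthogonal a.2 b.2
    have h2 : ⟪U₀ a, ((U₁ b : W'ᗮ) : F)⟫_ℝ = 0 :=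
      Submodule.inner_right_of_mem_orthogonal (K := W') ⟨a, rfl⟩ (U₁ b).2
    rw [hL, ← mul_self_inj_of_nonneg (norm_nonneg _) (norm_nonneg _),
      norm_add_sq_eq_norm_sq_add_norm_sq_real h1, norm_add_sq_eq_norm_sq_add_norm_sq_real h2,
      U₀.norm_map]
    have h3 : ‖((U₁ b : W'ᗮ) : F)‖ = ‖(b : E)‖ := U₁.norm_map b
    rw [h3]
    rfl
  · obtain ⟨⟨a, b⟩, rfl⟩ := e.surjective x
    change L (ρ g (a + b)) = σ g (L (a + b))
    have h1 := hL ⟨ρ g a, hW g a a.2⟩ ⟨ρ g b, hWo g b b.2⟩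
    have h2 : ((U₁ ⟨ρ g b, hWo g b b.2⟩ : W'ᗮ) : F) = σ g (U₁ b) :=
      congrArg Subtype.val (hU₁ g b)
    rw [hL, map_add (ρ g), map_add (σ g), ← hU₀, ← h2]
    exact h1

/-- Homomorphisms into `SO(m)` with the same character are conjugate by an orthogonal matrix. -/
theorem exists_orthogonal_conj {Γ : Type*} [Group Γ] {m : ℕ} (ρ σ : Γ →* SO m)
    (htr : ∀ g, trace (ρ g : Matrix (Fin m) (Fin m) ℝ) = trace (σ g : Matrix (Fin m) (Fin m) ℝ)) :
    ∃ U : Matrix (Fin m) (Fin m) ℝ, U * Uᵀ = 1 ∧ ∀ g, U * (ρ g).1 = (σ g).1 * U := by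
  have hmul (A B : Matrix (Fin m) (Fin m) ℝ) :
      Matrix.toEuclideanLin (A * B) = Matrix.toEuclideanLin A ∘ₗ Matrix.toEuclideanLin B := by
    ext; simp [Matrix.toEuclideanLin]
  have hone : Matrix.toEuclideanLin (1 : Matrix (Fin m) (Fin m) ℝ) = LinearMap.id := by
    ext; simp
  have hadj (A : Matrix (Fin m) (Fin m) ℝ) :
      Matrix.toEuclideanLin Aᵀ = (Matrix.toEuclideanLin A).adjoint := by
    rw [← Matrix.toEuclideanLin_conjTranspose_eq_adjoint, Matrix.conjTranspose_eq_transpose_of_trivial]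
  let rep (ρ : Γ →* SO m) : Representation ℝ Γ (EuclideanSpace ℝ (Fin m)) :=
    { toFun g := Matrix.toEuclideanLin (ρ g).1
      map_one' := by rw [map_one]; exact hone
      map_mul' g h := by rw [map_mul]; exact hmul _ _ }
  have horth (ρ : Γ →* SO m) : (rep ρ).IsOrthogonal := by
    intro g x y
    change ⟪Matrix.toEuclideanLin (ρ g).1 x, Matrix.toEuclideanLin (ρ g).1 y⟫_ℝ = _
    rw [← LinearMap.adjoint_inner_right, ← hadj, ← LinearMap.comp_apply, ← hmul,
      SO.transpose_mul, hone, LinearMap.id_apply]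
  have htrace (ρ : Γ →* SO m) (g : Γ) : LinearMap.trace ℝ _ (rep ρ g) = trace (ρ g).1 := by
    change LinearMap.trace ℝ _ (Matrix.toEuclideanLin (ρ g).1) = _
    rw [Matrix.toEuclideanLin_eq_toLin_orthonormal, Matrix.trace_toLin_eq]
  obtain ⟨U, hU⟩ := exists_isometry_of_trace_eq m (ρ := rep ρ) (σ := rep σ) (by simp)
    (horth ρ) (horth σ) (by simpa only [htrace] using htr)
  set M : Matrix (Fin m) (Fin m) ℝ := Matrix.toEuclideanLin.symm U.toLinearMap with hM
  have hMU : Matrix.toEuclideanLin M = U.toLinearMap := by rw [hM, LinearEquiv.apply_symm_apply]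
  refine ⟨M, mul_eq_one_comm.1 (Matrix.toEuclideanLin.injective ?_), fun g =>
    Matrix.toEuclideanLin.injective ?_⟩
  · rw [hmul, hadj, hone, hMU]
    refine LinearMap.ext fun x => ext_inner_right ℝ fun y => ?_
    rw [LinearMap.comp_apply, LinearMap.adjoint_inner_left]
    exact U.inner_map_map x y
  · rw [hmul, hmul, hMU]
    exact LinearMap.ext fun x => hU g x

/-- Homomorphisms into `SO(m)`, `m` odd, with the same character are conjugate in `SO(m)`. -/
theorem exists_conj_of_trace_eq {Γ : Type*} [Group Γ] {m : ℕ} (hm : Odd m) (ρ σ : Γ →* SO m)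
    (htr : ∀ g, trace (ρ g : Matrix (Fin m) (Fin m) ℝ) = trace (σ g : Matrix (Fin m) (Fin m) ℝ)) :
    ∃ u : SO m, ∀ g, u * ρ g * u⁻¹ = σ g := by
  obtain ⟨U, hU, hconj⟩ := exists_orthogonal_conj ρ σ htr
  have hdet := congrArg Matrix.det hU
  rw [Matrix.det_mul, Matrix.det_transpose, Matrix.det_one] at hdet
  rcases mul_self_eq_one_iff.1 hdet with h1 | h1
  · refine ⟨SO.mk U hU h1, fun g => ?_⟩
    rw [mul_inv_eq_iff_eq_mul]
    exact Subtype.ext (hconj g)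
  · refine ⟨SO.mk (-U) (by simpa using hU) (by
      rw [Matrix.det_neg, h1, Fintype.card_fin, hm.neg_one_pow]; norm_num), fun g => ?_⟩
    rw [mul_inv_eq_iff_eq_mul]
    refine Subtype.ext ?_
    change -U * (ρ g).1 = (σ g).1 * -U
    rw [Matrix.neg_mul, Matrix.mul_neg, hconj]

/-! ### Failure of strong control of fusion -/

theorem sum_exp_root_of_unity {n : ℕ} {θ : ℝ}
    (hθ : Complex.exp (θ * Complex.I) ^ (2 * n + 1) = 1) :
    ∑ j ∈ Finset.range (2 * n + 1), Complex.exp (((j : ℂ) - n) * θ * Complex.I) =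
      if Complex.exp (θ * Complex.I) = 1 then (2 * n + 1 : ℂ) else 0 := by
  have h1 (j : ℕ) : Complex.exp (((j : ℂ) - n) * θ * Complex.I) =
      Complex.exp (-n * θ * Complex.I) * Complex.exp (θ * Complex.I) ^ j := by
    rw [← Complex.exp_nat_mul, ← Complex.exp_add]
    congr 1; ring
  simp_rw [h1]
  rw [← Finset.mul_sum]
  split_ifs with h
  · have : Complex.exp (-n * θ * Complex.I) = 1 := by
      have : (-n * θ * Complex.I : ℂ) = -(n * (θ * Complex.I)) := by ring
      rw [this, Complex.exp_neg, Complex.exp_nat_mul, h, one_pow, inv_one]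
    rw [this, h]
    simp
  · rw [geom_sum_eq h, hθ, sub_self, zero_div, mul_zero]

theorem IsIrrepOfSO3.eq_one_of_map_eq_one {n : ℕ} (hn : 1 ≤ n) {ρ : SO 3 →* SO (2 * n + 1)}
    (hρ : IsIrrepOfSO3 ρ) {z : SO 3} (hz : ρ z = 1) : z = 1 := by
  obtain ⟨y, t, rfl⟩ := exists_conj_rotZ z
  have h1 : ρ (rotZ t) = 1 := by
    rw [map_mul, map_mul, map_inv, mul_inv_eq_one, mul_eq_left] at hz
    exact hz
  have h2 := hρ.trace_rotZ_eq_sum_cos hn t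
  rw [h1] at h2
  simp only [Submonoid.coe_one, Matrix.trace_one, Fintype.card_fin] at h2
  have hcos : cos t = 1 := by
    by_contra hne
    have hlt : cos t < 1 := lt_of_le_of_ne (cos_le_one t) hne
    have : ∑ j ∈ Finset.range (2 * n + 1), cos (((j : ℝ) - n) * t) <
        ∑ j ∈ Finset.range (2 * n + 1), (1 : ℝ) :=
      Finset.sum_lt_sum (fun j _ => cos_le_one _)
        ⟨n + 1, Finset.mem_range.2 (by omega), by simpa using hlt⟩
    rw [← h2] at this
    simp at this
  rw [rotZ_eq_one_of_cos_eq_one hcos]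
  simp

theorem rotZ_zpow (t : ℝ) (k : ℤ) : rotZ t ^ k = rotZ (k * t) := by
  let f : Multiplicative ℝ →* SO 3 :=
    { toFun s := rotZ s.toAdd
      map_one' := rotZ_zero
      map_mul' s t := rotZ_add _ _ }
  have := map_zpow f (Multiplicative.ofAdd t) k
  simpa [f] using this.symm

theorem not_stronglyControlsFusion_range {n : ℕ} (hn : 2 ≤ n) {ρ : SO 3 →* SO (2 * n + 1)}
    (hρ : IsIrrepOfSO3 ρ) : ¬ StronglyControlsFusion ρ.range := by
  intro hscf
  set α : ℝ := 2 * π / (2 * n + 1 : ℕ) with hα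
  have hN0 : ((2 * n + 1 : ℕ) : ℝ) ≠ 0 := by positivity
  have hroot (k : ℤ) : Complex.exp (((k * α : ℝ) : ℂ) * Complex.I) ^ (2 * n + 1) = 1 := by
    rw [← Complex.exp_nat_mul, Complex.exp_eq_one_iff]
    refine ⟨k, ?_⟩
    have : ((2 * n + 1 : ℕ) : ℝ) * (k * α) = k * (2 * π) := by rw [hα]; field_simp
    have h' := congrArg (fun x : ℝ => (x : ℂ) * Complex.I) this
    push_cast at h' ⊢
    linear_combination h'
  have hρtr (k : ℤ) : ((trace (ρ (rotZ (k * α))).1 : ℝ) : ℂ) =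
      if Complex.exp (((k * α : ℝ) : ℂ) * Complex.I) = 1 then (2 * n + 1 : ℂ) else 0 := by
    rw [hρ.trace_rotZ (by omega), sum_exp_root_of_unity (hroot k)]
  let x : SO 3 := rotZ α
  let f₁ : Multiplicative ℤ →* SO (2 * n + 1) := ρ.comp (zpowersHom (SO 3) x)
  let f₂ : Multiplicative ℤ →* SO (2 * n + 1) := ρ.comp (zpowersHom (SO 3) (x ^ 2))
  obtain ⟨u, hu⟩ := exists_conj_of_trace_eq ⟨n, rfl⟩ f₁ f₂ (by
    intro k
    have e₁ : f₁ k = ρ (rotZ ((k.toAdd : ℤ) * α)) := by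
      simp [f₁, x, rotZ_zpow]
    have e₂ : f₂ k = ρ (rotZ (((2 * k.toAdd : ℤ) : ℝ) * α)) := by
      simp only [f₂, MonoidHom.comp_apply, zpowersHom_apply, x, ← zpow_natCast, rotZ_zpow]
      congr 2
      push_cast
      ring
    rw [e₁, e₂]
    apply Complex.ofReal_injective
    rw [hρtr, hρtr]
    set z := Complex.exp ((((k.toAdd : ℤ) * α : ℝ) : ℂ) * Complex.I) with hz
    have hz2 : Complex.exp (((((2 * k.toAdd : ℤ) : ℝ) * α : ℝ) : ℂ) * Complex.I) = z ^ 2 := by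
      rw [hz, ← Complex.exp_nat_mul]
      congr 1
      push_cast
      ring
    rw [hz2]
    have hiff : z = 1 ↔ z ^ 2 = 1 := by
      refine ⟨fun h => by rw [h, one_pow], fun h => ?_⟩
      have := hroot k.toAdd
      rw [← hz, pow_succ, pow_mul, h, one_pow, one_mul] at this
      exact this
    simp only [hiff])
  have hux : u * ρ x * u⁻¹ = ρ (x ^ 2) := by
    simpa [f₁, f₂] using hu (Multiplicative.ofAdd 1)
  obtain ⟨_, ⟨y, rfl⟩, hy⟩ := hscf {ρ x} {ρ (x ^ 2)}
    (Set.singleton_subset_iff.2 ⟨_, rfl⟩) (Set.singleton_subset_iff.2 ⟨_, rfl⟩) u (by simp [hux])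
  have h1 : x ^ 2 = y * x * y⁻¹ := by
    have := hy (ρ x) rfl
    rw [hux, ← map_inv, ← map_mul, ← map_mul] at this
    rw [← mul_inv_eq_one]
    apply hρ.eq_one_of_map_eq_one (by omega)
    rw [map_mul, this, ← map_mul, mul_inv_cancel, map_one]
  have h2 : cos (2 * α) = cos α := by
    have h3 := SO.trace_conj y x
    rw [← h1] at h3
    have h4 : x ^ 2 = rotZ (2 * α) := by rw [two_mul, rotZ_add, pow_two]
    rw [h4, trace_rotZ, trace_rotZ] at h3
    linarith
  have hNpos : (0 : ℝ) < (2 * n + 1 : ℕ) := by positivity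
  have hα0 : 0 < α := by positivity
  have hα1 : 2 * α ≤ π := by
    have : (5 : ℝ) ≤ (2 * n + 1 : ℕ) := by exact_mod_cast (by omega : 5 ≤ 2 * n + 1)
    rw [hα, ← mul_div_assoc, div_le_iff₀ hNpos]
    nlinarith [pi_pos]
  have := cos_lt_cos_of_nonneg_of_le_pi hα0.le hα1 (by linarith)
  linarith

/-! ### Strong control of fusion by the eight-dimensional representation -/

theorem trace_sq (x : SO 3) : trace ((x * x : SO 3) : Matrix (Fin 3) (Fin 3) ℝ) =
    trace (x : Matrix (Fin 3) (Fin 3) ℝ) ^ 2 - 2 * trace (x : Matrix (Fin 3) (Fin 3) ℝ) := by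
  obtain ⟨y, t, rfl⟩ := exists_conj_rotZ x
  have : y * rotZ t * y⁻¹ * (y * rotZ t * y⁻¹) = y * rotZ (t + t) * y⁻¹ := by
    rw [rotZ_add]; group
  rw [this, SO.trace_conj, SO.trace_conj, trace_rotZ, trace_rotZ, ← two_mul, cos_two_mul]
  ring

theorem trace_map_conj {m : ℕ} (ρ : SO 3 →* SO m) (y x : SO 3) :
    trace (ρ (y * x * y⁻¹) : Matrix (Fin m) (Fin m) ℝ) = trace (ρ x : Matrix (Fin m) (Fin m) ℝ) := by
  rw [map_mul, map_mul, map_inv, SO.trace_conj]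

theorem trace_directSumRep {ρ₁ : SO 3 →* SO 3} {ρ₂ : SO 3 →* SO 5} (h₁ : IsIrrepOfSO3 ρ₁)
    (h₂ : IsIrrepOfSO3 ρ₂) (x : SO 3) :
    trace (directSumRep ρ₁ ρ₂ x : Matrix (Fin (3 + 5)) (Fin (3 + 5)) ℝ) =
      trace (x : Matrix (Fin 3) (Fin 3) ℝ) ^ 2 - 1 := by
  have hsum : trace (directSumRep ρ₁ ρ₂ x : Matrix (Fin (3 + 5)) (Fin (3 + 5)) ℝ) =
      trace (ρ₁ x : Matrix (Fin 3) (Fin 3) ℝ) + trace (ρ₂ x : Matrix (Fin 5) (Fin 5) ℝ) := by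
    change trace (_root_.blockDiag (ρ₁ x).1 (ρ₂ x).1) = _
    change ∑ i, fromBlocks (ρ₁ x).1 0 0 (ρ₂ x).1 (finSumFinEquiv.symm i) (finSumFinEquiv.symm i) = _
    rw [Equiv.sum_comp finSumFinEquiv.symm fun k => fromBlocks (ρ₁ x).1 0 0 (ρ₂ x).1 k k]
    simp [Matrix.trace, Fintype.sum_sum_type]
  rw [hsum]
  obtain ⟨y, t, rfl⟩ := exists_conj_rotZ x
  rw [trace_map_conj, trace_map_conj, SO.trace_conj, trace_rotZ]
  have e₁ : trace (ρ₁ (rotZ t)).1 = cos t + 1 + cos t := by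
    have h := IsIrrepOfSO3.trace_rotZ_eq_sum_cos (n := 1) le_rfl h₁ t
    norm_num [Finset.sum_range_succ] at h
    exact h
  have e₂ : trace (ρ₂ (rotZ t)).1 = cos (2 * t) + cos t + 1 + cos t + cos (2 * t) := by
    have h := IsIrrepOfSO3.trace_rotZ_eq_sum_cos (n := 2) one_le_two h₂ t
    norm_num [Finset.sum_range_succ] at h
    exact h
  rw [e₁, e₂, cos_two_mul]
  ring

theorem stronglyControlsFusion_directSumRep {ρ₁ : SO 3 →* SO 3} {ρ₂ : SO 3 →* SO 5}
    (h₁ : IsIrrepOfSO3 ρ₁) (h₂ : IsIrrepOfSO3 ρ₂) :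
    StronglyControlsFusion (directSumRep ρ₁ ρ₂).range := by
  intro B₁ B₂ hB₁ hB₂ g hg
  set τ := directSumRep ρ₁ ρ₂ with hτ
  let K : Subgroup (SO 3 × SO 3) :=
    { carrier := {p | g * τ p.1 * g⁻¹ = τ p.2}
      one_mem' := by simp
      mul_mem' := by
        intro p q hp hq
        simp only [Set.mem_ofPred_eq] at hp hq ⊢
        rw [Prod.fst_mul, Prod.snd_mul, map_mul, map_mul, ← hp, ← hq]
        group
      inv_mem' := by
        intro p hp
        simp only [Set.mem_ofPred_eq] at hp ⊢
        rw [Prod.fst_inv, Prod.snd_inv, map_inv, map_inv, ← hp]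
        group }
  have hsq (p : SO 3 × SO 3) (hp : p ∈ K) : trace p.1.1 ^ 2 = trace p.2.1 ^ 2 := by
    have h : g * τ p.1 * g⁻¹ = τ p.2 := hp
    have h' := SO.trace_conj g (τ p.1)
    rw [h] at h'
    rw [trace_directSumRep h₁ h₂, trace_directSumRep h₁ h₂] at h'
    linarith
  obtain ⟨u, hu⟩ := exists_conj_of_trace_eq (m := 3) ⟨1, rfl⟩
    ((MonoidHom.fst _ _).comp K.subtype) ((MonoidHom.snd _ _).comp K.subtype) (by
      rintro ⟨p, hp⟩
      change trace p.1.1 = trace p.2.1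
      have e1 := hsq p hp
      have e2 := hsq (p * p) (K.mul_mem hp hp)
      rw [Prod.fst_mul, Prod.snd_mul, trace_sq, trace_sq] at e2
      rcases sq_eq_sq_iff_eq_or_eq_neg.1 e1 with h | h
      · exact h
      · rw [h] at e2 ⊢
        have : trace p.2.1 ^ 3 = 0 := by linear_combination e2 / 8
        rw [pow_eq_zero_iff (by norm_num)] at this
        rw [this, neg_zero])
  refine ⟨τ u, ⟨u, rfl⟩, fun b hb => ?_⟩
  obtain ⟨x, rfl⟩ := hB₁ hb
  obtain ⟨y, hy⟩ := hB₂ (hg ▸ Set.mem_image_of_mem _ hb)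
  have := hu ⟨(x, y), hy.symm⟩
  rw [← map_inv, ← map_mul, ← map_mul, ← hy]
  exact congrArg τ this.symm

/-! ### Real forms of stable subspaces -/

section RealForm

theorem OrthonormalBasis.linearIndependent_coe {ι E : Type*} [Fintype ι] [NormedAddCommGroup E]
    [InnerProductSpace ℝ E] {S : Submodule ℝ E} (b : OrthonormalBasis ι ℝ S) :
    LinearIndependent ℝ fun k => (b k : E) := by
  have := b.toBasis.linearIndependent.map' S.subtype (Submodule.ker_subtype _)
  simpa [Function.comp_def] using this

variable {T : Type}

/-- The real vectors in a complex subspace. -/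
def realPoints (W : Submodule ℂ (T → ℂ)) : Submodule ℝ (EuclideanSpace ℝ T) where
  carrier := {x | (fun i => (x i : ℂ)) ∈ W}
  zero_mem' := by
    have : (fun i => (((0 : EuclideanSpace ℝ T) i : ℝ) : ℂ)) = 0 := by ext; simp
    change (fun i => (((0 : EuclideanSpace ℝ T) i : ℝ) : ℂ)) ∈ W
    rw [this]
    exact W.zero_mem
  add_mem' {x y} hx hy := by
    have : (fun i => (((x + y : EuclideanSpace ℝ T) i : ℝ) : ℂ)) =
        (fun i => (x i : ℂ)) + fun i => (y i : ℂ) := by ext; simp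
    change (fun i => (((x + y : EuclideanSpace ℝ T) i : ℝ) : ℂ)) ∈ W
    rw [this]
    exact W.add_mem hx hy
  smul_mem' c x hx := by
    have : (fun i => (((c • x : EuclideanSpace ℝ T) i : ℝ) : ℂ)) =
        (c : ℂ) • fun i => (x i : ℂ) := by ext; simp
    change (fun i => (((c • x : EuclideanSpace ℝ T) i : ℝ) : ℂ)) ∈ W
    rw [this]
    exact W.smul_mem _ hx

theorem mem_realPoints {W : Submodule ℂ (T → ℂ)} {x : EuclideanSpace ℝ T} :
    x ∈ realPoints W ↔ (fun i => (x i : ℂ)) ∈ W := Iff.rfl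

/-- The complex linear combinations of real vectors. -/
noncomputable def complexCombination {d : ℕ} (b : Fin d → EuclideanSpace ℝ T) :
    (Fin d → ℂ) →ₗ[ℂ] (T → ℂ) :=
  Fintype.linearCombination ℂ fun k i => (b k i : ℂ)

theorem complexCombination_apply {d : ℕ} (b : Fin d → EuclideanSpace ℝ T) (c : Fin d → ℂ) (i : T) :
    complexCombination b c i = ∑ k, c k * (b k i : ℂ) := by
  simp [complexCombination, Fintype.linearCombination_apply]

theorem complexCombination_injective {d : ℕ} {b : Fin d → EuclideanSpace ℝ T}
    (hb : LinearIndependent ℝ b) : Function.Injective (complexCombination b) := by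
  rw [injective_iff_map_eq_zero]
  intro c hc
  rw [Fintype.linearIndependent_iff] at hb
  have hre := hb (fun k => (c k).re) (by
    ext i
    have := congrArg Complex.re (congrFun hc i)
    rw [complexCombination_apply] at this
    simpa using this)
  have him := hb (fun k => (c k).im) (by
    ext i
    have := congrArg Complex.im (congrFun hc i)
    rw [complexCombination_apply] at this
    simpa using this)
  exact funext fun k => Complex.ext (hre k) (him k)

variable [Fintype T]

theorem range_complexCombination {d : ℕ} {W : Submodule ℂ (T → ℂ)} (hW : ∀ w ∈ W, star w ∈ W)
    (b : OrthonormalBasis (Fin d) ℝ (realPoints W)) :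
    LinearMap.range (complexCombination fun k => (b k : EuclideanSpace ℝ T)) = W := by
  set Φ := complexCombination fun k => (b k : EuclideanSpace ℝ T)
  apply le_antisymm
  · rintro _ ⟨c, rfl⟩
    have : Φ c = ∑ k, c k • fun i => ((b k : EuclideanSpace ℝ T) i : ℂ) := by
      ext i
      simp [Φ, complexCombination_apply]
    rw [this]
    exact W.sum_mem fun k _ => W.smul_mem _ (b k).2
  · have hreal (x : EuclideanSpace ℝ T) (hx : x ∈ realPoints W) :
        (fun i => (x i : ℂ)) ∈ LinearMap.range Φ := by
      refine ⟨fun k => (b.repr ⟨x, hx⟩ k : ℂ), ?_⟩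
      ext i
      rw [complexCombination_apply]
      have h1 := congrArg (fun y : realPoints W => (y : EuclideanSpace ℝ T) i)
        (b.sum_repr ⟨x, hx⟩)
      simp only [Submodule.coe_sum, Submodule.coe_smul] at h1
      rw [← h1]
      simp
    intro w hw
    have h1 := hreal (WithLp.toLp 2 fun i => (w i).re) (by
      rw [mem_realPoints]
      have := W.smul_mem (1 / 2 : ℂ) (W.add_mem hw (hW w hw))
      convert this using 1
      ext i
      simp [Complex.re_eq_add_conj]
      ring)
    have h2 := hreal (WithLp.toLp 2 fun i => (w i).im) (by
      rw [mem_realPoints]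
      have := W.smul_mem (1 / (2 * Complex.I) : ℂ) (W.sub_mem hw (hW w hw))
      convert this using 1
      ext i
      change ((w i).im : ℂ) = 1 / (2 * Complex.I) * (w i - star (w i))
      rw [Complex.im_eq_sub_conj, Complex.star_def]
      ring)
    have h3 := Submodule.add_mem _ h1 (Submodule.smul_mem _ Complex.I h2)
    convert h3 using 1
    ext i
    simp [mul_comm Complex.I, Complex.re_add_im]

variable [DecidableEq T]

/-- The complex operators given by real matrices. -/
noncomputable def complexify (τ : SO 3 →* Matrix T T ℝ) : SO 3 →* ((T → ℂ) →L[ℂ] (T → ℂ)) where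
  toFun g := LinearMap.toContinuousLinearMap (Matrix.toLin' ((τ g).map Complex.ofRealHom))
  map_one' := by
    rw [map_one, Matrix.map_one _ (map_zero _) (map_one _), Matrix.toLin'_one]; rfl
  map_mul' g h := by
    rw [map_mul, Matrix.map_mul, Matrix.toLin'_mul]; rfl

theorem complexify_apply (τ : SO 3 →* Matrix T T ℝ) (g : SO 3) (x : T → ℂ) (i : T) :
    complexify τ g x i = ∑ j, (τ g i j : ℂ) * x j := rfl

theorem continuous_complexify {τ : SO 3 →* Matrix T T ℝ} (hτ : Continuous τ) :
    Continuous (complexify τ) := by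
  have h1 : Continuous fun g : SO 3 => (τ g).map Complex.ofRealHom :=
    hτ.matrix_map Complex.continuous_ofReal
  have h2 : Continuous ((LinearMap.toContinuousLinearMap (𝕜 := ℂ) (E := T → ℂ)
      (F' := T → ℂ)).toLinearMap ∘ₗ (Matrix.toLin' (R := ℂ) (m := T) (n := T)).toLinearMap) :=
    LinearMap.continuous_of_finiteDimensional _
  exact h2.comp h1

theorem complexify_star (τ : SO 3 →* Matrix T T ℝ) (g : SO 3) (x : T → ℂ) :
    complexify τ g (star x) = star (complexify τ g x) := by
  ext i
  simp [complexify_apply]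

/-- A stable, conjugation invariant, minimal complex subspace gives an irreducible real
representation of the same dimension. -/
theorem exists_isIrrepOfSO3_of_minimal {τ : SO 3 →* Matrix T T ℝ} (hτ : Continuous τ)
    (horth : ∀ g, (τ g)ᵀ = τ g⁻¹) {W : Submodule ℂ (T → ℂ)} {d : ℕ} (hd : 0 < d)
    (hdim : Module.finrank ℂ W = d) (hstar : ∀ w ∈ W, star w ∈ W)
    (hinv : ∀ g, ∀ w ∈ W, complexify τ g w ∈ W)
    (hmin : ∀ U ≤ W, U ≠ ⊥ → (∀ g, ∀ u ∈ U, complexify τ g u ∈ U) → U = W) :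
    ∃ ρ : SO 3 →* SO d, IsIrrepOfSO3 ρ := by
  have hfin : Module.finrank ℝ (realPoints W) = d := by
    have h1 := range_complexCombination hstar (stdOrthonormalBasis ℝ (realPoints W))
    have h2 := LinearMap.finrank_range_of_inj
      (complexCombination_injective (stdOrthonormalBasis ℝ (realPoints W)).linearIndependent_coe)
    rw [h1, hdim] at h2
    simpa using h2.symm
  let b : OrthonormalBasis (Fin d) ℝ (realPoints W) :=
    (stdOrthonormalBasis ℝ (realPoints W)).reindex (finCongr hfin)
  set Φ := complexCombination fun k => (b k : EuclideanSpace ℝ T) with hΦ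
  have hΦrange : LinearMap.range Φ = W := range_complexCombination hstar b
  have hΦinj : Function.Injective Φ := complexCombination_injective b.linearIndependent_coe
  let R (g : SO 3) : EuclideanSpace ℝ T →ₗ[ℝ] EuclideanSpace ℝ T := Matrix.toEuclideanLin (τ g)
  have hR (g : SO 3) (x : EuclideanSpace ℝ T) (i : T) : R g x i = ∑ j, τ g i j * x j := rfl
  have hRW (g : SO 3) : ∀ x ∈ realPoints W, R g x ∈ realPoints W := by
    intro x hx
    rw [mem_realPoints] at hx ⊢
    convert hinv g _ hx using 1
    ext i
    rw [hR, complexify_apply]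
    push_cast
    rfl
  let M : SO 3 →* Matrix (Fin d) (Fin d) ℝ :=
    { toFun g := LinearMap.toMatrix b.toBasis b.toBasis ((R g).restrict (hRW g))
      map_one' := by
        rw [← LinearMap.toMatrix_one b.toBasis]
        congr 1
        ext x i
        simp [R]
      map_mul' g h := by
        rw [← LinearMap.toMatrix_mul]
        congr 1
        ext x i
        simp [R, Matrix.toEuclideanLin, LinearMap.restrict_apply] }
  have hM (g : SO 3) (k l : Fin d) : M g k l =
      ⟪(b k : EuclideanSpace ℝ T), R g (b l)⟫_ℝ := by
    change LinearMap.toMatrix b.toBasis b.toBasis ((R g).restrict (hRW g)) k l = _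
    rw [LinearMap.toMatrix_apply]
    simp [b.repr_apply_apply]
  have hMt (g : SO 3) : (M g)ᵀ = M g⁻¹ := by
    ext k l
    have hadj : R g⁻¹ = (R g).adjoint := by
      change Matrix.toEuclideanLin (τ g⁻¹) = _
      rw [← horth, ← Matrix.conjTranspose_eq_transpose_of_trivial,
        Matrix.toEuclideanLin_conjTranspose_eq_adjoint]
    rw [Matrix.transpose_apply, hM, hM, hadj, LinearMap.adjoint_inner_right, real_inner_comm]
  have hMorth (g : SO 3) : M g * (M g)ᵀ = 1 := by
    rw [hMt, ← map_mul, mul_inv_cancel, map_one]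
  have hMdet (g : SO 3) : (M g).det = 1 := by
    obtain ⟨y, t, rfl⟩ := exists_conj_rotZ g
    have h1 := congrArg Matrix.det (hMorth y)
    have h2 := congrArg Matrix.det (hMorth (rotZ (t / 2)))
    rw [Matrix.det_mul, Matrix.det_transpose, Matrix.det_one] at h2
    rw [hMt, Matrix.det_mul, Matrix.det_one] at h1
    rw [map_mul, map_mul, Matrix.det_mul, Matrix.det_mul, mul_right_comm, h1, one_mul,
      ← add_halves t, rotZ_add, map_mul, Matrix.det_mul, h2]
  let ρ : SO 3 →* SO d :=
    { toFun g := SO.mk (M g) (hMorth g) (hMdet g)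
      map_one' := Subtype.ext (by simp)
      map_mul' g h := Subtype.ext (by simp) }
  refine ⟨ρ, ?_, ?_⟩
  · refine Continuous.subtype_mk (continuous_matrix fun k l => ?_) _
    simp_rw [hM, PiLp.inner_apply, hR]
    have hentry (i j : T) : Continuous fun g => τ g i j := hτ.matrix_elem i j
    fun_prop
  have hcol (g : SO 3) (l : Fin d) (i : T) : ∑ k, M g k l * (b k : EuclideanSpace ℝ T) i =
      ∑ j, τ g i j * (b l : EuclideanSpace ℝ T) j := by
    rw [← hR]
    have h1 := congrArg (fun y : realPoints W => (y : EuclideanSpace ℝ T) i)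
      (b.sum_repr ((R g).restrict (hRW g) (b l)))
    simp only [b.repr_apply_apply, Submodule.coe_sum, Submodule.coe_smul] at h1
    simpa [hM] using h1
  have hequiv (g : SO 3) (c : Fin d → ℂ) :
      Φ (complexRep ρ g c) = complexify τ g (Φ c) := by
    have hrep (k : Fin d) : complexRep ρ g c k = ∑ l, (M g k l : ℂ) * c l := rfl
    ext i
    simp only [hΦ, complexify_apply, complexCombination_apply, hrep]
    calc ∑ k, (∑ l, (M g k l : ℂ) * c l) * ((b k : EuclideanSpace ℝ T) i : ℂ)
        = ∑ l, c l * ((∑ k, M g k l * (b k : EuclideanSpace ℝ T) i : ℝ) : ℂ) := by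
          simp_rw [Finset.sum_mul]
          rw [Finset.sum_comm]
          refine Finset.sum_congr rfl fun l _ => ?_
          push_cast
          rw [Finset.mul_sum]
          exact Finset.sum_congr rfl fun k _ => by ring
      _ = ∑ l, c l * ((∑ j, τ g i j * (b l : EuclideanSpace ℝ T) j : ℝ) : ℂ) := by
          simp_rw [hcol]
      _ = _ := by
          simp_rw [Finset.mul_sum]
          rw [Finset.sum_comm]
          refine Finset.sum_congr rfl fun l _ => ?_
          push_cast
          rw [Finset.mul_sum]
          exact Finset.sum_congr rfl fun k _ => by ring
  have : Nonempty (Fin d) := ⟨⟨0, hd⟩⟩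
  exact
    { exists_pair_ne := ⟨⊥, ⊤, fun h => bot_ne_top
        (congrArg Subrepresentation.toSubmodule h : (⊥ : Submodule ℂ (Fin d → ℂ)) = ⊤)⟩
      eq_bot_or_eq_top := by
        intro U
        by_cases h0 : U.toSubmodule = ⊥
        · exact Or.inl (Subrepresentation.toSubmodule_injective h0)
        refine Or.inr (Subrepresentation.toSubmodule_injective ?_)
        change U.toSubmodule = ⊤
        have := hmin (U.toSubmodule.map Φ) (by rw [← hΦrange]; exact LinearMap.map_le_range)
          ((Submodule.map_injective_of_injective hΦinj).ne_iff' (Submodule.map_bot Φ) |>.2 h0) (by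
            rintro g _ ⟨u, hu, rfl⟩
            exact ⟨_, U.apply_mem_toSubmodule g hu, hequiv g u⟩)
        rw [← hΦrange, ← Submodule.map_top] at this
        exact Submodule.map_injective_of_injective hΦinj this }

end RealForm

/-! ### Tensor powers of the standard representation -/

section Tensor

/-- The matrices of the action of `SO(3)` on the `n`-fold tensor power of `ℝ³`. -/
noncomputable def tensorPower (n : ℕ) :
    SO 3 →* Matrix (Fin n → Fin 3) (Fin n → Fin 3) ℝ where
  toFun g i j := ∏ k, g.1 (i k) (j k)
  map_one' := by
    ext i j
    by_cases h : i = j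
    · subst h; simp
    · obtain ⟨k, hk⟩ := Function.ne_iff.1 h
      rw [Matrix.one_apply_ne h]
      exact Finset.prod_eq_zero (Finset.mem_univ k) (by simp [hk])
  map_mul' g h := by
    ext i j
    change ∏ k, (g.1 * h.1) (i k) (j k) =
      ∑ l : Fin n → Fin 3, (∏ k, g.1 (i k) (l k)) * ∏ k, h.1 (l k) (j k)
    simp only [Matrix.mul_apply, ← Finset.prod_mul_distrib]
    rw [Finset.prod_univ_sum, Fintype.piFinset_univ]

theorem tensorPower_apply (n : ℕ) (g : SO 3) (i j : Fin n → Fin 3) :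
    tensorPower n g i j = ∏ k, g.1 (i k) (j k) := rfl

theorem continuous_tensorPower (n : ℕ) : Continuous (tensorPower n) := by
  refine continuous_matrix fun i j => ?_
  simp only [tensorPower_apply]
  exact continuous_finsetProd _ fun k _ => continuous_subtype_val.matrix_elem _ _

theorem transpose_tensorPower (n : ℕ) (g : SO 3) :
    (tensorPower n g)ᵀ = tensorPower n g⁻¹ := rfl

/-- The pure tensor power of a vector. -/
def pureTensor (n : ℕ) (u : Fin 3 → ℂ) (i : Fin n → Fin 3) : ℂ := ∏ k, u (i k)

theorem complexify_tensorPower_pureTensor (n : ℕ) (g : SO 3) (u : Fin 3 → ℂ) :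
    complexify (tensorPower n) g (pureTensor n u) =
      pureTensor n fun a => ∑ c, (g.1 a c : ℂ) * u c := by
  ext i
  simp only [complexify_apply, tensorPower_apply, pureTensor, Complex.ofReal_prod,
    ← Finset.prod_mul_distrib]
  rw [Finset.prod_univ_sum, Fintype.piFinset_univ]

/-- The infinitesimal action on pure tensors is by derivations. -/
theorem derivative_pureTensor {n : ℕ} {γ : ℝ → SO 3} (h0 : γ 0 = 1)
    {X : ((Fin n → Fin 3) → ℂ) →L[ℂ] ((Fin n → Fin 3) → ℂ)}
    (hX : HasDerivAt (fun t => complexify (tensorPower n) (γ t)) X 0) {u u' : Fin 3 → ℂ}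
    (hu : ∀ a, HasDerivAt (fun t => ∑ c, ((γ t).1 a c : ℂ) * u c) (u' a) 0)
    (i : Fin n → Fin 3) :
    X (pureTensor n u) i = ∑ k, (∏ l ∈ Finset.univ.erase k, u (i l)) * u' (i k) := by
  have h1 : HasDerivAt (fun t => complexify (tensorPower n) (γ t) (pureTensor n u) i)
      (X (pureTensor n u) i) 0 := by
    have := ((((ContinuousLinearMap.proj (R := ℂ) (φ := fun _ : Fin n → Fin 3 => ℂ) i).comp
      (ContinuousLinearMap.apply ℂ _ (pureTensor n u))).restrictScalars ℝ).hasFDerivAt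
      (x := complexify (tensorPower n) (γ 0))).comp_hasDerivAt (0 : ℝ) hX
    simpa [Function.comp_def] using this
  have h2 : HasDerivAt (fun t => ∏ k, ∑ c, ((γ t).1 (i k) c : ℂ) * u c)
      (∑ k, (∏ l ∈ Finset.univ.erase k, ∑ c, ((γ 0).1 (i l) c : ℂ) * u c) • u' (i k)) 0 :=
    HasDerivAt.fun_finsetProd fun k _ => hu (i k)
  simp_rw [complexify_tensorPower_pureTensor, pureTensor] at h1
  have hone (a : Fin 3) : ∑ c, (((1 : SO 3).1 a c : ℝ) : ℂ) * u c = u a := by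
    fin_cases a <;> simp [Fin.sum_univ_three]
  rw [h1.unique h2, h0]
  simp only [hone, smul_eq_mul]

end Tensor

theorem rotX_zero : rotX 0 = 1 := by
  rw [← rotCyc_mul_rotZ, rotZ_zero]; simp

theorem rotY_zero : rotY 0 = 1 := by
  rw [← rotCyc_mul_rotX, rotX_zero]; simp

theorem hasDerivAt_ofReal_cos_zero : HasDerivAt (fun t : ℝ => ((cos t : ℝ) : ℂ)) 0 0 := by
  simpa using (hasDerivAt_cos 0).ofReal_comp

theorem hasDerivAt_ofReal_sin_zero : HasDerivAt (fun t : ℝ => ((sin t : ℝ) : ℂ)) 1 0 := by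
  simpa using (hasDerivAt_sin 0).ofReal_comp

/-- The tensor power of an isotropic vector is annihilated by the raising operator and is a weight
vector. -/
theorem pureTensor_primitive {n : ℕ}
    {A B C : ((Fin n → Fin 3) → ℂ) →L[ℂ] ((Fin n → Fin 3) → ℂ)}
    (h : IsInfinitesimal (complexify (tensorPower n)) A B C) :
    (A + Complex.I • B) (pureTensor n ![1, Complex.I, 0]) = 0 ∧
      C (pureTensor n ![1, Complex.I, 0]) =
        (-(n * Complex.I)) • pureTensor n ![1, Complex.I, 0] := by
  have hc := hasDerivAt_ofReal_cos_zero
  have hs := hasDerivAt_ofReal_sin_zero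
  have hA := derivative_pureTensor rotX_zero h.hasDerivAt_x
    (u := ![1, Complex.I, 0]) (u' := ![0, 0, Complex.I]) (by
      intro a
      fin_cases a
      · simpa [rotX, Fin.sum_univ_three] using hasDerivAt_const (0 : ℝ) (1 : ℂ)
      · simpa [rotX, Fin.sum_univ_three] using hc.mul_const Complex.I
      · simpa [rotX, Fin.sum_univ_three] using hs.mul_const Complex.I)
  have hB := derivative_pureTensor rotY_zero h.hasDerivAt_y
    (u := ![1, Complex.I, 0]) (u' := ![0, 0, -1]) (by
      intro a
      fin_cases a
      · simpa [rotY, Fin.sum_univ_three] using hc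
      · simpa [rotY, Fin.sum_univ_three] using hasDerivAt_const (0 : ℝ) Complex.I
      · simpa [rotY, Fin.sum_univ_three] using hs.fun_neg)
  have hC := derivative_pureTensor rotZ_zero h.hasDerivAt_z
    (u := ![1, Complex.I, 0]) (u' := ![-Complex.I, 1, 0]) (by
      intro a
      fin_cases a
      · simpa [rotZ, Fin.sum_univ_three] using hc.fun_add (hs.mul_const Complex.I).fun_neg
      · simpa [rotZ, Fin.sum_univ_three] using hs.fun_add (hc.mul_const Complex.I)
      · simpa [rotZ, Fin.sum_univ_three] using hasDerivAt_const (0 : ℝ) (0 : ℂ))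
  constructor
  · ext i
    have hi (a : Fin 3) : (![0, 0, Complex.I] : Fin 3 → ℂ) a +
        Complex.I * (![0, 0, -1] : Fin 3 → ℂ) a = 0 := by
      fin_cases a <;> simp
    simp only [_root_.add_apply, _root_.smul_apply, Pi.add_apply, Pi.smul_apply, hA, hB,
      smul_eq_mul, Finset.mul_sum, ← Finset.sum_add_distrib, Pi.zero_apply]
    refine Finset.sum_eq_zero fun k _ => ?_
    linear_combination (∏ l ∈ Finset.univ.erase k, (![1, Complex.I, 0] : Fin 3 → ℂ) (i l)) *
      hi (i k)
  · ext i
    have hi (a : Fin 3) : (![-Complex.I, 1, 0] : Fin 3 → ℂ) a =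
        -Complex.I * (![1, Complex.I, 0] : Fin 3 → ℂ) a := by
      fin_cases a <;> simp
    have hprod (k : Fin n) :
        (∏ l ∈ Finset.univ.erase k, (![1, Complex.I, 0] : Fin 3 → ℂ) (i l)) *
          (![-Complex.I, 1, 0] : Fin 3 → ℂ) (i k) =
        -Complex.I * pureTensor n ![1, Complex.I, 0] i := by
      rw [hi, pureTensor, ← Finset.prod_erase_mul _ _ (Finset.mem_univ k)]
      ring
    rw [hC, Finset.sum_congr rfl fun k _ => hprod k]
    simp
    ring

theorem complexify_rotX_pi_pureTensor (n : ℕ) :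
    complexify (tensorPower n) (rotX π) (pureTensor n ![1, Complex.I, 0]) =
      star (pureTensor n ![1, Complex.I, 0]) := by
  rw [complexify_tensorPower_pureTensor]
  ext i
  simp only [pureTensor, Pi.star_apply, star_prod]
  refine Finset.prod_congr rfl fun k _ => ?_
  generalize i k = a
  fin_cases a <;> simp [rotX, Fin.sum_univ_three]

section LieTriple

attribute [local instance] LieRing.ofAssociativeRing

theorem exists_isIrrepOfSO3_of_pos {n : ℕ} (hn : 1 ≤ n) :
    ∃ ρ : SO 3 →* SO (2 * n + 1), IsIrrepOfSO3 ρ := by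
  obtain ⟨A, B, C, h⟩ := exists_isInfinitesimal
    (continuous_complexify (continuous_tensorPower n))
  set v := pureTensor n ![1, Complex.I, 0] with hv
  obtain ⟨hE, hC⟩ := pureTensor_primitive h
  rw [← hv] at hE hC
  have hv0 : v ≠ 0 := by
    intro h0
    have := congrFun h0 fun _ => 0
    simp [hv, pureTensor] at this
  have hC0 : C ≠ 0 := by
    rintro rfl
    have hn0 : n ≠ 0 := by omega
    have := hC.symm
    simp [hv0, hn0] at this
  have P : (h.isSl2Triple hC0).HasPrimitiveVectorWith v ((2 * n : ℕ) : ℂ) :=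
    { ne_zero := hv0
      lie_h := by
        change (2 * Complex.I) • C v = _
        rw [hC, smul_smul]
        congr 1
        push_cast
        linear_combination (-2 * n : ℂ) * Complex.I_mul_I
      lie_e := hE }
  set W := Submodule.span ℂ (Set.range fun j : Fin (2 * n + 1) =>
    (((Complex.I • B - A : ((Fin n → Fin 3) → ℂ) →L[ℂ] ((Fin n → Fin 3) → ℂ)) :
      ((Fin n → Fin 3) → ℂ) →ₗ[ℂ] ((Fin n → Fin 3) → ℂ)) ^ (j : ℕ)) v) with hW
  have hinv (g : SO 3) : ∀ w ∈ W, complexify (tensorPower n) g w ∈ W :=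
    fun w hw => h.lower_span_invariant P g hw
  have hmin (U : Submodule ℂ ((Fin n → Fin 3) → ℂ)) (hU : U ≤ W) (h0 : U ≠ ⊥)
      (hUinv : ∀ g, ∀ u ∈ U, complexify (tensorPower n) g u ∈ U) : U = W :=
    h.eq_lower_span P hU h0 hUinv
  have hvW : v ∈ W := Submodule.subset_span ⟨0, by simp⟩
  let Wbar : Submodule ℂ ((Fin n → Fin 3) → ℂ) :=
    { carrier := {w | star w ∈ W}
      zero_mem' := by simp
      add_mem' := by
        intro x y hx hy
        simp only [Set.mem_ofPred_eq] at hx hy ⊢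
        rw [star_add]
        exact W.add_mem hx hy
      smul_mem' := by
        intro c x hx
        simp only [Set.mem_ofPred_eq] at hx ⊢
        rw [star_smul]
        exact W.smul_mem _ hx }
  have hbar : W ⊓ Wbar = W := by
    refine hmin _ inf_le_left ?_ ?_
    · intro hbot
      have hmem : v ∈ W ⊓ Wbar := ⟨hvW, by
        change star v ∈ W
        rw [hv, ← complexify_rotX_pi_pureTensor]
        exact hinv _ _ hvW⟩
      rw [hbot, Submodule.mem_bot] at hmem
      exact hv0 hmem
    · rintro g u ⟨hu, hu'⟩
      refine ⟨hinv g u hu, ?_⟩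
      change star (complexify (tensorPower n) g u) ∈ W
      rw [← complexify_star]
      exact hinv g _ hu'
  refine exists_isIrrepOfSO3_of_minimal (continuous_tensorPower n) (transpose_tensorPower n)
    (by omega) ?_ (fun w hw => ?_) hinv hmin
  · rw [hW, finrank_span_eq_card P.linearIndependent_lower, Fintype.card_fin]
  · rw [← hbar] at hw
    exact hw.2

end LieTriple

theorem isIrrepOfSO3_one : IsIrrepOfSO3 (1 : SO 3 →* SO 1) := by
  refine ⟨continuous_const, ?_⟩
  have : IsSimpleModule ℂ (Fin 1 → ℂ) := isSimpleModule_iff_finrank_eq_one.2 (by simp)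
  exact
    { exists_pair_ne := ⟨⊥, ⊤, fun h => bot_ne_top
        (congrArg Subrepresentation.toSubmodule h : (⊥ : Submodule ℂ (Fin 1 → ℂ)) = ⊤)⟩
      eq_bot_or_eq_top := fun U => (eq_bot_or_eq_top U.toSubmodule).imp
        (fun h => Subrepresentation.toSubmodule_injective h)
        (fun h => Subrepresentation.toSubmodule_injective h) }

theorem exists_isIrrepOfSO3 (n : ℕ) : ∃ ρ : SO 3 →* SO (2 * n + 1), IsIrrepOfSO3 ρ := by
  rcases Nat.eq_zero_or_pos n with rfl | hn
  · exact ⟨_, isIrrepOfSO3_one⟩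
  · exact exists_isIrrepOfSO3_of_pos hn

theorem mainTheorem11 :
    (∀ n : ℕ, ∃ ρ : SO 3 →* SO (2 * n + 1), IsIrrepOfSO3 ρ) ∧
    (∀ n : ℕ, 2 ≤ n → ∀ ρ : SO 3 →* SO (2 * n + 1), IsIrrepOfSO3 ρ →
      ¬ StronglyControlsFusion ρ.range) ∧
    (∀ (ρ₁ : SO 3 →* SO 3) (ρ₂ : SO 3 →* SO 5), IsIrrepOfSO3 ρ₁ → IsIrrepOfSO3 ρ₂ →
      StronglyControlsFusion ((directSumRep ρ₁ ρ₂).range : Subgroup (SO 8))) :=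
  ⟨exists_isIrrepOfSO3, fun _ hn _ hρ => not_stronglyControlsFusion_range hn hρ,
    fun _ _ h₁ h₂ => stronglyControlsFusion_directSumRep h₁ h₂⟩
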